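/- **Setting.** Let $E$ be a CW complex with cells $\mathcal{E}_k$ in dimension $k$ ($\mathcal{E}_{-1}=\emptyset$), with a chosen orientation of each cell, and let $d_{\alpha\beta}\in\mathbb{Z}$ be the incidence number of $\alpha\in\mathcal{E}_{k+1}$ and $\beta\in\mathcal{E}_k$ (the degree of the attaching map of $\alpha$ followed by the collapse of the complement of $\beta$ in the $k$-skeleton). Assume that for every cell $\beta$ only finitely many $\alpha$ have $d_{\alpha\beta}\neq0$. Let $G$ be a finite abelian group, $\hat G$ its group of characters (written additively), and $n\in\mathbb{N}$. Put $C_k^{\mathrm{lf}}(E;\hat G)=\prod_{\mathcal{E}_k}\hat G$ and $C^k(E;G)=\prod_{\mathcal{E}_k}G$, with subgroups $C_k(E;\hat G)$ and $C^k_{\mathrm{lf}}(E;G)$ of finitely supported elements, and $$\partial\Big(\sum_\alpha\chi_\alpha e_\alpha\Big)=\sum_\beta\Big(\sum_\alpha d_{\alpha\beta}\chi_\alpha\Big)e_\beta,\qquad \partial^T\Big(\sum_\beta g_\beta e_\beta\Big)=\sum_\alpha\Big(\sum_\beta d_{\alpha\beta}g_\beta\Big)e_\alpha .$$ The class at infinity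 of $\gamma\in C_n^{\mathrm{lf}}(E;\hat G)$ with finitely supported $\partial\gamma$ is its class in $H^\infty_{n-1}(E;\hat G)$, the group of such chains modulo $C_n(E;\hat G)+\partial C_{n+1}^{\mathrm{lf}}(E;\hat G)$. The class at infinity of $\delta\in C^n(E;G)$ with finitely supported $\partial^T\delta$ is its class in $H_\infty^n(E;G)$, the group of such cochains modulo $C^n_{\mathrm{lf}}(E;G)+\partial^TC^{n-1}(E;G)$. For a finite set $K$ of cells, $c_K$ denotes the restriction of $c$ to $K$. Let $\mathfrak{A}$ be the quasi-local C*-algebra with one copy of $B(\ell^2(G))$ for each $n$-cell. For finitely supported $a=\sum_\alpha a_\alpha e_\alpha\in C^n_{\mathrm{lf}}(E;G)$ and $b=\sum_\alpha b_\alpha e_\alpha\in C_n(E;\hat G)$ let $X^a,Z^b\in\mathfrak{A}$ be the products over the sites of the unitaries $|h\rangle\mapsto|h+a_\alpha\rangle$ and $|h\rangle\mapsto b_\alpha(h)|h\rangle$, respectively. For $\gamma\in C_n^{\mathrm{lf}}(E;\hat G)$ and $\delta\in C^n(E;G)$ let $\rho_{(\gamma,\delta)}=\rho_\gamma\circ\rho_\delta$,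 where $\rho_\gamma(A)=\lim_K Z^{\gamma_K}AZ^{-\gamma_K}$ and $\rho_\delta(A)=\lim_K X^{\delta_K}AX^{-\delta_K}$ (norm limits over the finite sets $K\subseteq\mathcal{E}_n$). Let $\omega_0$ be a frustration free ground state, that is, a state on $\mathfrak{A}$ with $\omega_0(X^{\partial^Tc}Z^{\partial d})=1$ for all $c\in C^{n-1}_{\mathrm{lf}}(E;G)$ and $d\in C_{n+1}(E;\hat G)$, and let $(\mathcal{H},\pi_0,\Omega_0)$ be its GNS representation. **Proposition.** Let $\gamma,\gamma'\in C_n^{\mathrm{lf}}(E;\hat G)$ have finitely supported boundaries and equal classes in $H^\infty_{n-1}(E;\hat G)$, and let $\delta,\delta'\in C^n(E;G)$ have finitely supported coboundaries and equal classes in $H^n_\infty(E;G)$. Then there are $\hat\gamma\in C_n(E;\hat G)$, $\hat\delta\in C^n_{\mathrm{lf}}(E;G)$, $p\in C^{\mathrm{lf}}_{n+1}(E;\hat G)$ and $q\in C^{n-1}(E;G)$ such that $$\gamma'=\gamma-\hat\gamma+\partial p,\qquad \delta'=\delta-\hat\delta+\partial^Tq .$$ For every such choice, the net of operators $$\pi_0\big(Z^{-\hat\gamma}X^{-\hat\delta}X^{\partial^T(q_{K_-})}Z^{\partial(p_{K_+})}\big),$$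 indexed by the pairs of finite sets $K_+\subseteq\mathcal{E}_{n+1}$, $K_-\subseteq\mathcal{E}_{n-1}$ ordered by inclusion, converges in the strong operator topology to a unitary operator $U$ on $\mathcal{H}$, which satisfies $$U\,\pi_0(\rho_{(\gamma,\delta)}(A))=\pi_0(\rho_{(\gamma',\delta')}(A))\,U\quad\text{for all }A\in\mathfrak{A},\qquad\text{and}\qquad \pi_0(X^{\hat\delta}Z^{\hat\gamma})\,U\,\Omega_0=\Omega_0 .$$ -/

import Mathlib

noncomputable section

section topology

open Topology Metric

/-- The sphere of dimension `k`, realised as the boundary of the cube `[-1, 1] ^ (k + 1)`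
(the unit sphere for the maximum norm, as in Mathlib's characteristic maps of cells). -/
abbrev CubeSphere (k : ℕ) : Type := sphere (0 : Fin (k + 1) → ℝ) 1

/-- Singular homology in degree `k` with integer coefficients. -/
abbrev singularH (k : ℕ) : CategoryTheory.Functor TopCat.{0} (ModuleCat.{0} ℤ) :=
  (AlgebraicTopology.singularHomologyFunctor (ModuleCat.{0} ℤ) k).obj (ModuleCat.of ℤ ℤ)

/-- The map from a space to the point. -/
def toPoint (Y : TopCat.{0}) : Y ⟶ TopCat.of PUnit.{1} :=
  TopCat.ofHom ⟨fun _ => PUnit.unit, continuous_const⟩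

/-- `d` is a degree of the self-map `f` of the `k`-sphere if `f` acts as multiplication by `d` on
the reduced homology group in degree `k`, i.e. on the kernel of the map from the `k`-th homology of
the sphere to the `k`-th homology of a point (this covers `k = 0` as well). -/
def IsSphereDegree {k : ℕ} (f : C(CubeSphere k, CubeSphere k)) (d : ℤ) : Prop :=
  ∀ x : (singularH k).obj (TopCat.of (CubeSphere k)),
    (singularH k).map (toPoint (TopCat.of (CubeSphere k))) x = 0 →
      (singularH k).map (TopCat.ofHom f) x = d • x

open Classical in
/-- The degree of a self-map of the `k`-sphere. (The reduced homology group is infinite cyclic, so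
there is exactly one such integer.) -/
def sphereDegree {k : ℕ} (f : C(CubeSphere k, CubeSphere k)) : ℤ :=
  if h : ∃! d : ℤ, IsSphereDegree f d then h.choose else 0

lemma sphereDegree_const {k : ℕ} (y : CubeSphere k) :
    sphereDegree (ContinuousMap.const (CubeSphere k) y) = 0 := by
  unfold sphereDegree
  split_ifs with h
  · refine h.unique h.choose_spec.1 ?_
    intro x hx
    have hfac : TopCat.ofHom (ContinuousMap.const (CubeSphere k) y) =
        CategoryTheory.CategoryStruct.comp (toPoint (TopCat.of (CubeSphere k)))
          (TopCat.ofHom (ContinuousMap.const PUnit.{1} y)) := rfl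
    rw [hfac, CategoryTheory.Functor.map_comp]
    simp [hx]
  · rfl

/-- The vector `(1 - 2r, (1 - r) x)` with `r = ‖x‖`; it is never zero. -/
def pinchVec (k : ℕ) (x : Fin k → ℝ) : Fin (k + 1) → ℝ :=
  Fin.cons (1 - 2 * ‖x‖) ((1 - ‖x‖) • x)

lemma pinchVec_ne_zero (k : ℕ) (x : Fin k → ℝ) : pinchVec k x ≠ 0 := by
  intro h
  have h0 : 1 - 2 * ‖x‖ = 0 := by simpa [pinchVec] using congrFun h 0
  have h1 : (1 - ‖x‖) • x = 0 := by
    funext i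
    simpa [pinchVec] using congrFun h i.succ
  have hx : ‖x‖ = 1 / 2 := by linarith
  rcases smul_eq_zero.1 h1 with h2 | h2
  · linarith
  · rw [h2, norm_zero] at hx; norm_num at hx

/-- The standard map `D ^ k → S ^ k` which collapses the boundary of the cube to the base point
`(-1, 0, …, 0)` and is injective on the interior, so that it identifies `D ^ k / ∂ D ^ k` with the
sphere. (For `k = 0` it sends the point `D ^ 0` to the point of `S ^ 0` that is not the base
point.) -/
def pinch (k : ℕ) (x : Fin k → ℝ) : CubeSphere k :=
  ⟨‖pinchVec k x‖⁻¹ • pinchVec k x, by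
    simp [norm_smul, inv_mul_cancel₀ (norm_ne_zero_iff.2 (pinchVec_ne_zero k x))]⟩

/-- The base point `(-1, 0, …, 0)` of the `k`-sphere. -/
def sphereBase (k : ℕ) : CubeSphere k :=
  ⟨Fin.cons (-1) 0, by
    rw [mem_sphere_zero_iff_norm]
    apply le_antisymm
    · refine (pi_norm_le_iff_of_nonneg zero_le_one).2 fun i => ?_
      refine Fin.cases ?_ (fun j => ?_) i <;> simp
    · simpa using norm_le_pi_norm (Fin.cons (-1) 0 : Fin (k + 1) → ℝ) 0⟩

lemma continuous_pinch (k : ℕ) : Continuous (pinch k) := by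
  have hv : Continuous (pinchVec k) := by
    refine continuous_pi fun i => ?_
    refine Fin.cases ?_ (fun j => ?_) i
    · simp only [pinchVec, Fin.cons_zero]; fun_prop
    · simp only [pinchVec, Fin.cons_succ, Pi.smul_apply, smul_eq_mul]; fun_prop
  exact ((hv.norm.inv₀ fun x => norm_ne_zero_iff.2 (pinchVec_ne_zero k x)).smul hv).subtype_mk _

lemma pinch_of_norm_eq_one {k : ℕ} {x : Fin k → ℝ} (hx : ‖x‖ = 1) : pinch k x = sphereBase k := by
  have h : pinchVec k x = (sphereBase k : Fin (k + 1) → ℝ) := by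
    simp only [pinchVec, sphereBase, hx]
    norm_num
  apply Subtype.ext
  have hn : ‖(sphereBase k : Fin (k + 1) → ℝ)‖ = 1 := by
    exact mem_sphere_zero_iff_norm.1 (sphereBase k).2
  simp only [pinch, h, hn, inv_one, one_smul]

section cells

variable {X : Type*} [TopologicalSpace X] [T2Space X] {E : Set X} [CWComplex E]

open Classical in
/-- The map which collapses the complement of the open cell `β` to a point, with values in the
sphere `D ^ k / ∂ D ^ k = S ^ k` of that cell. -/
def collapse {k : ℕ} (β : RelCWComplex.cell E k) (x : X) : CubeSphere k :=
  if x ∈ RelCWComplex.openCell k β then pinch k ((RelCWComplex.map k β).symm x) else sphereBase k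

/-- The composition `S ^ k → X → S ^ k` of the attaching map of the `(k + 1)`-cell `α` with the
collapsing map of the `k`-cell `β`. -/
def attachCollapse {k : ℕ} (α : RelCWComplex.cell E (k + 1)) (β : RelCWComplex.cell E k)
    (x : CubeSphere k) : CubeSphere k :=
  collapse β (RelCWComplex.map (k + 1) α x)

lemma collapse_map {k : ℕ} (β : RelCWComplex.cell E k) {y : Fin k → ℝ} (hy : y ∈ closedBall 0 1) :
    collapse β (RelCWComplex.map k β y) = pinch k y := by
  classical
  rcases (mem_closedBall_zero_iff.1 hy).lt_or_eq with h | h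
  · have hb : y ∈ ball (0 : Fin k → ℝ) 1 := mem_ball_zero_iff.2 h
    have hm : RelCWComplex.map k β y ∈ RelCWComplex.openCell k β := Set.mem_image_of_mem _ hb
    rw [collapse, if_pos hm, (RelCWComplex.map k β).left_inv]
    rwa [RelCWComplex.source_eq]
  · rw [collapse, if_neg, pinch_of_norm_eq_one h]
    intro hmem
    have hf : RelCWComplex.map k β y ∈ RelCWComplex.cellFrontier k β :=
      Set.mem_image_of_mem _ (mem_sphere_zero_iff_norm.2 h)
    have hs := CWComplex.cellFrontier_subset_skeletonLT k β hf
    exact (CWComplex.disjoint_skeletonLT_openCell (C := E) (n := k) (m := k) le_rfl).le_bot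
      ⟨hs, hmem⟩

/-- The finitely many `k`-cells which the boundary of a `(k + 1)`-cell may meet, with a closed set
which contains the rest of the boundary and misses all open `k`-cells outside the finite set. -/
lemma exists_attaching_cover {k : ℕ} (α : RelCWComplex.cell E (k + 1)) :
    ∃ I : Finset (RelCWComplex.cell E k), ∀ x : CubeSphere k,
      RelCWComplex.map (k + 1) α x ∈ (RelCWComplex.skeletonLT E k : Set X) ∪
        ⋃ j ∈ I, RelCWComplex.closedCell k j := by
  obtain ⟨I, hI⟩ := CWComplex.cellFrontier_subset_finite_closedCell (k + 1) α
  refine ⟨I k, fun x => ?_⟩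
  have hx := hI (Set.mem_image_of_mem (RelCWComplex.map (k + 1) α) x.2)
  simp only [Set.mem_iUnion] at hx
  obtain ⟨m, hm, j, hj, hx⟩ := hx
  rcases (Nat.lt_succ_iff.1 hm).lt_or_eq with h | rfl
  · left
    refine CWComplex.skeletonLT_mono ?_ (CWComplex.closedCell_subset_skeletonLT m j hx)
    exact_mod_cast h
  · right
    simp only [Set.mem_iUnion]
    exact ⟨j, hj, hx⟩

lemma disjoint_closedCell_openCell {k : ℕ} {j β : RelCWComplex.cell E k} (h : j ≠ β) :
    Disjoint (RelCWComplex.closedCell k j) (RelCWComplex.openCell k β) := by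
  rw [← CWComplex.cellFrontier_union_openCell_eq_closedCell, Set.disjoint_union_left]
  refine ⟨?_, CWComplex.disjoint_openCell_of_ne (by simpa using h)⟩
  exact (CWComplex.disjoint_skeletonLT_openCell (C := E) (n := k) (m := k) le_rfl).mono_left
    (CWComplex.cellFrontier_subset_skeletonLT k j)

lemma continuous_attachCollapse {k : ℕ} (α : RelCWComplex.cell E (k + 1))
    (β : RelCWComplex.cell E k) : Continuous (attachCollapse α β) := by
  classical
  obtain ⟨I, hI⟩ := exists_attaching_cover α
  set A : Set X := (RelCWComplex.skeletonLT E k : Set X) ∪ ⋃ j ∈ I.erase β, RelCWComplex.closedCell k j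
  have hA : IsClosed A := by
    refine (RelCWComplex.skeletonLT E k).closed.union ?_
    exact (I.erase β).finite_toSet.isClosed_biUnion fun j _ => CWComplex.isClosed_closedCell
  have hAβ : Disjoint A (RelCWComplex.openCell k β) := by
    refine Set.disjoint_union_left.2
      ⟨CWComplex.disjoint_skeletonLT_openCell (C := E) (n := k) (m := k) le_rfl, ?_⟩
    simp only [Set.disjoint_iUnion_left]
    exact fun j hj => disjoint_closedCell_openCell (Finset.ne_of_mem_erase hj)
  have hcA : ContinuousOn (collapse β) A := by
    refine (continuousOn_const (c := sphereBase k)).congr fun x hx => ?_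
    exact if_neg fun h => hAβ.le_bot ⟨hx, h⟩
  have hB : IsClosed (RelCWComplex.closedCell k β) := CWComplex.isClosed_closedCell
  have hcB : ContinuousOn (collapse β) (RelCWComplex.closedCell k β) := by
    rw [continuousOn_iff_continuous_domRestrict]
    let q : closedBall (0 : Fin k → ℝ) 1 → RelCWComplex.closedCell k β :=
      fun y => ⟨RelCWComplex.map k β y, Set.mem_image_of_mem _ y.2⟩
    have hq : Continuous q :=
      (continuousOn_iff_continuous_domRestrict.1 (RelCWComplex.continuousOn k β)).subtype_mk _
    have hs : Function.Surjective q := by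
      rintro ⟨x, y, hy, rfl⟩
      exact ⟨⟨y, hy⟩, rfl⟩
    have : CompactSpace (closedBall (0 : Fin k → ℝ) 1) :=
      isCompact_iff_compactSpace.1 (isCompact_closedBall _ _)
    have hqm : IsQuotientMap q := IsQuotientMap.of_surjective_continuous hs hq
    rw [hqm.continuous_iff]
    have : (RelCWComplex.closedCell k β).domRestrict (collapse β) ∘ q = fun y => pinch k y.1 := by
      funext y
      exact collapse_map β y.2
    rw [this]
    exact (continuous_pinch k).comp continuous_subtype_val
  have hc := hcA.union_of_isClosed hcB hA hB
  have hφ : Continuous fun x : CubeSphere k => RelCWComplex.map (k + 1) α x :=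
    continuousOn_iff_continuous_domRestrict.1
      ((RelCWComplex.continuousOn (k + 1) α).mono sphere_subset_closedBall)
  refine hc.comp_continuous hφ fun x => ?_
  rcases hI x with h | h
  · exact Or.inl (Or.inl h)
  · simp only [Set.mem_iUnion] at h
    obtain ⟨j, hj, hx⟩ := h
    by_cases hjβ : j = β
    · exact Or.inr (hjβ ▸ hx)
    · refine Or.inl (Or.inr ?_)
      simp only [Set.mem_iUnion]
      exact ⟨j, Finset.mem_erase.2 ⟨hjβ, hj⟩, hx⟩

lemma finite_attachCollapse_degree {k : ℕ} (α : RelCWComplex.cell E (k + 1)) :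
    {β : RelCWComplex.cell E k |
      sphereDegree ⟨attachCollapse α β, continuous_attachCollapse α β⟩ ≠ 0}.Finite := by
  classical
  obtain ⟨I, hI⟩ := exists_attaching_cover α
  refine I.finite_toSet.subset fun β hβ => ?_
  by_contra hn
  refine hβ ?_
  convert sphereDegree_const (sphereBase k) using 2
  ext1 x
  refine if_neg fun h => ?_
  rcases hI x with h' | h'
  · exact (CWComplex.disjoint_skeletonLT_openCell (C := E) (n := k) (m := k) le_rfl).le_bot ⟨h', h⟩
  · simp only [Set.mem_iUnion] at h'
    obtain ⟨j, hj, hx⟩ := h'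
    exact (disjoint_closedCell_openCell (fun e => hn (by rw [← e]; exact hj))).le_bot ⟨hx, h⟩

end cells

end topology

/-- Incidence numbers between a set `A` of cells of some dimension and a set `B` of cells of
dimension one less: an integer matrix with finitely many nonzero entries in each row and column. -/
structure Incidence (A B : Type*) where
  /-- The incidence number of `α` and `β`. -/
  coeff : A → B → ℤ
  finite_faces : ∀ α, {β | coeff α β ≠ 0}.Finite
  finite_cofaces : ∀ β, {α | coeff α β ≠ 0}.Finite

namespace Incidence

variable {A B M : Type*} [AddCommGroup M] (d : Incidence A B)

/-- The boundary map on locally finite chains, `∂ (∑ χ_α e_α) = ∑_β (∑_α d_αβ χ_α) e_β`. -/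
def boundary : (A → M) →+ (B → M) where
  toFun c := fun β => ∑ᶠ α, d.coeff α β • c α
  map_zero' := by funext β; simp
  map_add' c c' := by
    funext β
    simp only [Pi.add_apply, smul_add]
    refine finsum_add_distrib ?_ ?_ <;>
    · refine (d.finite_cofaces β).subset fun α hα h => hα ?_
      simp [h]

/-- The coboundary map on cochains, `∂ᵀ (∑ g_β e_β) = ∑_α (∑_β d_αβ g_β) e_α`. -/
def coboundary : (B → M) →+ (A → M) where
  toFun c := fun α => ∑ᶠ β, d.coeff α β • c β
  map_zero' := by funext β; simp
  map_add' c c' := by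
    funext α
    simp only [Pi.add_apply, smul_add]
    refine finsum_add_distrib ?_ ?_ <;>
    · refine (d.finite_faces α).subset fun β hβ h => hβ ?_
      simp [h]

lemma finite_support_boundary (c : A →₀ M) : (Function.support (d.boundary ⇑c)).Finite := by
  refine (c.support.finite_toSet.biUnion fun α _ => d.finite_faces α).subset fun β hβ => ?_
  obtain ⟨α, hα⟩ : ∃ α, d.coeff α β • c α ≠ 0 := by
    by_contra! h
    exact hβ (by simp [boundary, h])
  simp only [Set.mem_iUnion]
  exact ⟨α, by simpa using fun h : c α = 0 => hα (by simp [h]), fun h => hα (by simp [h])⟩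

lemma finite_support_coboundary (c : B →₀ M) : (Function.support (d.coboundary ⇑c)).Finite := by
  refine (c.support.finite_toSet.biUnion fun β _ => d.finite_cofaces β).subset fun α hα => ?_
  obtain ⟨β, hβ⟩ : ∃ β, d.coeff α β • c β ≠ 0 := by
    by_contra! h
    exact hα (by simp [coboundary, h])
  simp only [Set.mem_iUnion]
  exact ⟨β, by simpa using fun h : c β = 0 => hβ (by simp [h]), fun h => hβ (by simp [h])⟩

/-- The boundary map on (finite) chains: the restriction of `boundary`. -/
def finBoundary (c : A →₀ M) : B →₀ M :=
  Finsupp.ofSupportFinite (d.boundary ⇑c) (d.finite_support_boundary c)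

/-- The coboundary map on locally finite (i.e. finitely supported) cochains: the restriction of
`coboundary`. -/
def finCoboundary (c : B →₀ M) : A →₀ M :=
  Finsupp.ofSupportFinite (d.coboundary ⇑c) (d.finite_support_coboundary c)

end Incidence

/-- The subgroup of finitely supported functions. -/
def finiteChains (S M : Type*) [AddCommGroup M] : AddSubgroup (S → M) where
  carrier := {c | (Function.support c).Finite}
  zero_mem' := by simp
  add_mem' {c c'} hc hc' := (hc.union hc').subset (Function.support_add c c')
  neg_mem' {c} hc := by
    refine Set.Finite.subset hc fun x hx h => hx ?_
    simp [h]

section infinity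

/-! Homology and cohomology at infinity in the middle of `A → S → B`, where `S` is the set of
`n`-cells, `A` the set of `(n + 1)`-cells and `B` the set of `(n - 1)`-cells. -/

variable {A S B : Type*} (D : Incidence A S) (d : Incidence S B) (M : Type*) [AddCommGroup M]

/-- `(n - 1)`-cycles at infinity: locally finite `n`-chains with finite boundary. -/
def cyclesAtInfinity : AddSubgroup (S → M) := (finiteChains B M).comap d.boundary

/-- `(n - 1)`-boundaries at infinity: boundaries of locally finite `(n + 1)`-chains, up to finite
`n`-chains. -/
def boundariesAtInfinity : AddSubgroup (S → M) :=
  finiteChains S M ⊔ (D.boundary (M := M)).range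

/-- The homology group `H^∞_{n - 1}` at infinity. -/
abbrev HomologyAtInfinity : Type _ :=
  cyclesAtInfinity d M ⧸ (boundariesAtInfinity D M).addSubgroupOf (cyclesAtInfinity d M)

/-- `n`-cocycles at infinity: `n`-cochains with finite coboundary. -/
def cocyclesAtInfinity : AddSubgroup (S → M) := (finiteChains A M).comap D.coboundary

/-- `n`-coboundaries at infinity: coboundaries of `(n - 1)`-cochains, up to finite `n`-cochains. -/
def coboundariesAtInfinity : AddSubgroup (S → M) :=
  finiteChains S M ⊔ (d.coboundary (M := M)).range

/-- The cohomology group `H_∞^n` at infinity. -/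
abbrev CohomologyAtInfinity : Type _ :=
  cocyclesAtInfinity D M ⧸ (coboundariesAtInfinity d M).addSubgroupOf (cocyclesAtInfinity D M)

end infinity

/-- The restriction `c_K` of a chain or cochain `c` to a finite set `K` of cells. -/
def truncate {S M : Type*} [AddCommGroup M] (K : Finset S) (c : S → M) : S →₀ M := by
  classical
  exact Finsupp.onFinset K (fun s => if s ∈ K then c s else 0) fun s h => by
    by_contra hs
    simp [hs] at h

section complex

open Topology

variable {X : Type*} [TopologicalSpace X] [T2Space X] (E : Set X) [CWComplex E]

/-- A choice of orientation of every cell, as a sign relative to the orientation which is given by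
the characteristic map. -/
abbrev CellOrientation : Type _ := ∀ k, RelCWComplex.cell E k → ℤˣ

variable {E} in
/-- The incidence number `d_αβ` of a `(k + 1)`-cell `α` and a `k`-cell `β`: the degree of the
attaching map of `α` followed by the map which collapses the complement of `β`. -/
def incidenceNumber (o : CellOrientation E) {k : ℕ} (α : RelCWComplex.cell E (k + 1))
    (β : RelCWComplex.cell E k) : ℤ :=
  o (k + 1) α * o k β * sphereDegree ⟨attachCollapse α β, continuous_attachCollapse α β⟩

/-- Every cell is incident to finitely many cells of the next dimension. -/
def HasFiniteCofaces (o : CellOrientation E) : Prop :=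
  ∀ (k : ℕ) (β : RelCWComplex.cell E k),
    {α : RelCWComplex.cell E (k + 1) | incidenceNumber o α β ≠ 0}.Finite

/-- The cells, with the index shifted by one: `Cells E k` is the set of cells of dimension `k - 1`,
which is empty for `k = 0`. -/
def Cells : ℕ → Type _
  | 0 => PEmpty
  | k + 1 => RelCWComplex.cell E k

variable {E} in
/-- The incidence numbers between cells of dimension `k` and cells of dimension `k - 1`. -/
def cellIncidence (o : CellOrientation E) (hE : HasFiniteCofaces E o) :
    (k : ℕ) → Incidence (Cells E (k + 1)) (Cells E k)
  | 0 =>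
    { coeff := fun _ _ => 0
      finite_faces := by simp
      finite_cofaces := by simp }
  | k + 1 =>
    { coeff := fun (α : RelCWComplex.cell E (k + 1)) (β : RelCWComplex.cell E k) =>
        incidenceNumber o α β
      finite_faces := fun α =>
        (finite_attachCollapse_degree (E := E) (k := k) α).subset fun _ hβ h =>
          hβ (mul_eq_zero_of_right _ h)
      finite_cofaces := hE k }

end complex

section conj

open Filter Topology

variable {R ι : Type*} [CStarAlgebra R] [SemilatticeSup ι] [Nonempty ι] (u : ι → R)
  (hu : ∀ K, u K * star (u K) = 1) (hu' : ∀ K, star (u K) * u K = 1)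

/-- The elements on which conjugation by a net of unitaries converges. -/
def conjConvergent (hu : ∀ K, u K * star (u K) = 1) (hu' : ∀ K, star (u K) * u K = 1) :
    StarSubalgebra ℂ R where
  carrier := {A | ∃ L, Tendsto (fun K => u K * A * star (u K)) atTop (𝓝 L)}
  mul_mem' := by
    rintro A B ⟨L, hL⟩ ⟨L', hL'⟩
    refine ⟨L * L', (hL.mul hL').congr fun K => ?_⟩
    calc _ = u K * A * (star (u K) * u K) * B * star (u K) := by simp only [mul_assoc]
      _ = _ := by rw [hu', mul_one, mul_assoc (u K)]
  add_mem' := by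
    rintro A B ⟨L, hL⟩ ⟨L', hL'⟩
    exact ⟨L + L', (hL.add hL').congr fun K => by rw [mul_add, add_mul]⟩
  algebraMap_mem' c := ⟨algebraMap ℂ _ c, tendsto_const_nhds.congr fun K => by
    rw [← Algebra.commutes, mul_assoc, hu, mul_one]⟩
  star_mem' := by
    rintro A ⟨L, hL⟩
    exact ⟨star L, (hL.star).congr fun K => by simp only [star_mul, star_star, mul_assoc]⟩

lemma isClosed_conjConvergent : IsClosed (conjConvergent u hu hu' : Set R) := by
  have hnorm : ∀ K B, ‖u K * B * star (u K)‖ = ‖B‖ := fun K B => by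
    have hm : u K ∈ unitary R := ⟨hu' K, hu K⟩
    rw [CStarRing.norm_mul_mem_unitary _ (Unitary.star_mem hm), CStarRing.norm_mem_unitary_mul _ hm]
  refine isClosed_of_closure_subset fun A hA => ?_
  refine cauchySeq_tendsto_of_complete (Metric.cauchySeq_iff'.2 fun ε hε => ?_)
  obtain ⟨B, ⟨L, hB⟩, hAB⟩ := Metric.mem_closure_iff.1 hA (ε / 3) (by positivity)
  obtain ⟨N, hN⟩ := Metric.cauchySeq_iff'.1 hB.cauchySeq (ε / 3) (by positivity)
  refine ⟨N, fun K hK => ?_⟩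
  have e : ∀ K, dist (u K * A * star (u K)) (u K * B * star (u K)) < ε / 3 := fun K => by
    rw [dist_eq_norm, ← sub_mul, ← mul_sub, hnorm, ← dist_eq_norm]
    exact hAB
  calc _ ≤ dist (u K * A * star (u K)) (u K * B * star (u K)) +
        dist (u K * B * star (u K)) (u N * B * star (u N)) +
        dist (u N * B * star (u N)) (u N * A * star (u N)) := dist_triangle4 _ _ _ _
    _ < ε / 3 + ε / 3 + ε / 3 := by
        gcongr
        · exact e K
        · exact hN K hK
        · rw [dist_comm]; exact e N
    _ = ε := by ring

end conj

section algebra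

variable (S G : Type*) [AddCommGroup G]

/-- The group `Ĝ` of characters of `G`, written additively. -/
def CharGroup (G : Type*) [AddCommGroup G] : Type _ := AddChar G ℂ

instance instAddCommGroupCharGroup (G : Type*) [AddCommGroup G] : AddCommGroup (CharGroup G) :=
  inferInstanceAs (AddCommGroup (AddChar G ℂ))

instance instFunLikeCharGroup (G : Type*) [AddCommGroup G] : FunLike (CharGroup G) G ℂ :=
  inferInstanceAs (FunLike (AddChar G ℂ) G ℂ)

/-- The infinite tensor product Hilbert space of copies of `ℓ²(G)`, one for each site in `S`, with
respect to the reference vectors `|0⟩`. It has the orthonormal basis of all `|h⟩`, where `h` is a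
finitely supported configuration. -/
abbrev SiteHilbert : Type _ := lp (fun _ : S →₀ G => ℂ) 2

variable {S G}

lemma CharGroup.zero_apply (g : G) : (0 : CharGroup G) g = 1 := AddChar.zero_apply (A := G) (M := ℂ) g

lemma CharGroup.neg_apply (χ : CharGroup G) (g : G) : (-χ) g = χ (-g) :=
  AddChar.neg_apply (A := G) (M := ℂ) χ g

lemma CharGroup.map_add (χ : CharGroup G) (g h : G) : χ (g + h) = χ g * χ h :=
  AddChar.map_add_eq_mul (A := G) (M := ℂ) χ g h

lemma CharGroup.map_zero (χ : CharGroup G) : χ 0 = 1 := AddChar.map_zero_eq_one (A := G) (M := ℂ) χ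

lemma memlp_comp_sub (a : S →₀ G) (ψ : SiteHilbert S G) :
    Memℓp (fun h : S →₀ G => ψ (h - a)) 2 := by
  refine memℓp_gen ?_
  have := (lp.memℓp ψ).summable (by norm_num)
  exact (Equiv.subRight a).summable_iff.2 this

/-- The translation operator `|h⟩ ↦ |h + a⟩`. -/
def translation (a : S →₀ G) : SiteHilbert S G →L[ℂ] SiteHilbert S G :=
  LinearMap.mkContinuous
    { toFun := fun ψ => ⟨fun h => ψ (h - a), memlp_comp_sub a ψ⟩
      map_add' := fun _ _ => rfl
      map_smul' := fun _ _ => rfl } 1 fun ψ => by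
    have h2 : 0 < (2 : ENNReal).toReal := by norm_num
    rw [one_mul]
    refine le_of_eq ?_
    rw [lp.norm_eq_tsum_rpow h2, lp.norm_eq_tsum_rpow h2]
    congr 1
    exact (Equiv.subRight a).tsum_eq fun h => ‖ψ h‖ ^ (2 : ENNReal).toReal

/-- The configuration which is `c` on `Λ` and `0` elsewhere. -/
def extendConf (Λ : Finset S) (c : Λ → G) : S →₀ G := by
  classical
  exact Finsupp.onFinset Λ (fun s => if h : s ∈ Λ then c ⟨s, h⟩ else 0) fun s h => by
    by_contra hs
    simp [hs] at h

/-- The restriction of a configuration to `Λ`. -/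
def restrictConf (Λ : Finset S) (h : S →₀ G) : Λ → G := fun s => h s

lemma translation_apply (a : S →₀ G) (ψ : SiteHilbert S G) (h : S →₀ G) :
    translation a ψ h = ψ (h - a) := rfl

lemma extendConf_restrictConf (a : S →₀ G) :
    extendConf a.support (restrictConf a.support a) = a := by
  ext s
  by_cases h : s ∈ a.support
  · simp [extendConf, restrictConf]
  · rw [Finsupp.notMem_support_iff.1 h]
    simp [extendConf, h]

variable [Fintype G]

open Classical in
lemma norm_diagonal_le (Λ : Finset S) (F : (Λ → G) → ℂ) (ψ : SiteHilbert S G) (h : S →₀ G) :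
    ‖F (restrictConf Λ h) * ψ h‖ ≤ ‖(((∑ y, ‖F y‖ : ℝ) : ℂ) • ψ : SiteHilbert S G) h‖ := by
  have h1 : ‖F (restrictConf Λ h)‖ ≤ ∑ y, ‖F y‖ :=
    Finset.single_le_sum (f := fun y => ‖F y‖) (fun _ _ => norm_nonneg _) (Finset.mem_univ _)
  rw [lp.coeFn_smul, Pi.smul_apply, norm_smul, norm_mul, Complex.norm_real]
  exact mul_le_mul_of_nonneg_right (h1.trans (le_abs_self _)) (norm_nonneg _)

open Classical in
/-- The diagonal operator `|h⟩ ↦ F(h|_Λ) |h⟩`. -/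
def diagonalOp (Λ : Finset S) (F : (Λ → G) → ℂ) : SiteHilbert S G →L[ℂ] SiteHilbert S G :=
  LinearMap.mkContinuous
    { toFun := fun ψ => ⟨fun h => F (restrictConf Λ h) * ψ h,
        (lp.memℓp (((∑ y, ‖F y‖ : ℝ) : ℂ) • ψ)).mono' (norm_diagonal_le Λ F ψ)⟩
      map_add' := fun ψ φ => Subtype.ext (funext fun h => mul_add _ (ψ h) (φ h))
      map_smul' := fun c ψ => Subtype.ext (funext fun h => mul_left_comm _ c (ψ h)) }
    (∑ y, ‖F y‖) fun ψ => by
    refine (lp.norm_mono (p := 2) (by norm_num) (norm_diagonal_le Λ F ψ)).trans ?_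
    rw [norm_smul, Complex.norm_real, Real.norm_of_nonneg]
    exact Finset.sum_nonneg fun _ _ => norm_nonneg _

open Classical in
/-- The local operator `M ⊗ 1`, where the matrix `M` acts on the sites in `Λ` and the identity on
all other sites. Its matrix element `⟨h| · |h'⟩` is `M (h|_Λ) (h'|_Λ)` if `h` and `h'` agree outside
of `Λ`, i.e. if `h' = h - c` for a configuration `c` on `Λ`, and `0` otherwise. -/
def localOp (Λ : Finset S) (M : Matrix (Λ → G) (Λ → G) ℂ) :
    SiteHilbert S G →L[ℂ] SiteHilbert S G :=
  ∑ c : Λ → G, diagonalOp Λ (fun x => M x (x - c)) * translation (extendConf Λ c)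

lemma diagonalOp_apply (Λ : Finset S) (F : (Λ → G) → ℂ) (ψ : SiteHilbert S G) (h : S →₀ G) :
    diagonalOp Λ F ψ h = F (restrictConf Λ h) * ψ h := rfl

open Classical in
lemma localOp_apply (Λ : Finset S) (M : Matrix (Λ → G) (Λ → G) ℂ) (ψ : SiteHilbert S G)
    (h : S →₀ G) :
    localOp Λ M ψ h = ∑ c : Λ → G,
      M (restrictConf Λ h) (restrictConf Λ h - c) * ψ (h - extendConf Λ c) := by
  rw [localOp, sum_apply, lp.coeFn_sum, Finset.sum_apply]
  rfl

variable (S G) in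
/-- The quasi-local algebra: the C*-algebra generated by all local operators, that is, the closure
of the union of the full matrix algebras of all finite sets of sites. -/
def quasiLocal : StarSubalgebra ℂ (SiteHilbert S G →L[ℂ] SiteHilbert S G) :=
  (StarAlgebra.adjoin ℂ (⋃ Λ : Finset S, Set.range (localOp (G := G) Λ))).topologicalClosure

instance isClosed_quasiLocal :
    IsClosed (quasiLocal S G : Set (SiteHilbert S G →L[ℂ] SiteHilbert S G)) :=
  StarSubalgebra.isClosed_topologicalClosure _

instance instCStarAlgebraQuasiLocal : CStarAlgebra (quasiLocal S G) := inferInstance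
instance instRingQuasiLocal : Ring (quasiLocal S G) := inferInstance
instance instAlgebraQuasiLocal : Algebra ℂ (quasiLocal S G) := inferInstance
instance instModuleQuasiLocal : Module ℂ (quasiLocal S G) := inferInstance
instance instStarRingQuasiLocal : StarRing (quasiLocal S G) := inferInstance

lemma localOp_mem (Λ : Finset S) (M : Matrix (Λ → G) (Λ → G) ℂ) : localOp Λ M ∈ quasiLocal S G :=
  StarSubalgebra.le_topologicalClosure _
    (StarAlgebra.subset_adjoin _ _ (Set.mem_iUnion.2 ⟨Λ, M, rfl⟩))

lemma translation_eq_localOp (a : S →₀ G) : ∃ M, translation a = localOp (G := G) a.support M := by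
  classical
  refine ⟨fun x y => if x - y = restrictConf a.support a then 1 else 0, ?_⟩
  refine ContinuousLinearMap.ext fun ψ => lp.ext (funext fun h => ?_)
  refine Eq.trans ?_ (localOp_apply a.support _ ψ h).symm
  rw [Finset.sum_eq_single (restrictConf a.support a)]
  · simp only [sub_sub_cancel, if_true, one_mul]
    rw [translation_apply, extendConf_restrictConf]
  · intro c _ hc
    simp [hc]
  · simp

lemma diagonalOp_eq_localOp (Λ : Finset S) (F : (Λ → G) → ℂ) :
    ∃ M, diagonalOp Λ F = localOp (G := G) Λ M := by
  classical
  refine ⟨Matrix.diagonal F, ?_⟩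
  refine ContinuousLinearMap.ext fun ψ => lp.ext (funext fun h => ?_)
  rw [localOp_apply, Finset.sum_eq_single 0]
  · have : extendConf Λ (0 : Λ → G) = 0 := by ext s; simp [extendConf]
    simp [diagonalOp_apply, this]
  · intro c _ hc
    rw [Matrix.diagonal_apply_ne, zero_mul]
    intro h
    exact hc (by simpa using h.symm)
  · simp

/-- `X^a`, the product of the shifts `|g⟩ ↦ |g + a_s⟩` at the sites `s`. -/
def pauliX (a : S →₀ G) : quasiLocal S G :=
  ⟨translation a, by
    obtain ⟨M, hM⟩ := translation_eq_localOp a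
    exact hM ▸ localOp_mem _ M⟩

/-- The eigenvalue `∏_s b_s(h_s)` of `Z^b` on the basis vector `|h⟩`. -/
def zPhase (b : S →₀ CharGroup G) (h : S →₀ G) : ℂ := b.prod fun s χ => χ (h s)

/-- `Z^b`, the product of the operators `|g⟩ ↦ b_s(g) |g⟩` at the sites `s`. -/
def pauliZ (b : S →₀ CharGroup G) : quasiLocal S G :=
  ⟨diagonalOp b.support fun x => ∏ s : b.support, b s (x s), by
    obtain ⟨M, hM⟩ := diagonalOp_eq_localOp (G := G) b.support fun x => ∏ s : b.support, b s (x s)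
    exact hM ▸ localOp_mem _ M⟩

lemma pauliX_apply (a : S →₀ G) (ψ : SiteHilbert S G) (h : S →₀ G) :
    (pauliX a : SiteHilbert S G →L[ℂ] SiteHilbert S G) ψ h = ψ (h - a) := rfl

lemma pauliZ_apply (b : S →₀ CharGroup G) (ψ : SiteHilbert S G) (h : S →₀ G) :
    (pauliZ b : SiteHilbert S G →L[ℂ] SiteHilbert S G) ψ h = zPhase b h * ψ h := by
  have : zPhase b h = ∏ s : b.support, b s (h s) :=
    (Finset.prod_coe_sort b.support fun s => b s (h s)).symm
  rw [this]
  rfl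

lemma zPhase_eq_prod (b : S →₀ CharGroup G) (h : S →₀ G) (T : Finset S) (hT : h.support ⊆ T) :
    zPhase b h = ∏ s ∈ T, b s (h s) := by
  classical
  have h1 : zPhase b h = ∏ s ∈ b.support ∪ T, b s (h s) := by
    refine Finset.prod_subset Finset.subset_union_left fun s _ hs => ?_
    have h0 := Finsupp.notMem_support_iff.1 hs
    simp only [h0, CharGroup.zero_apply]
  rw [h1]
  refine (Finset.prod_subset Finset.subset_union_right fun s _ hs => ?_).symm
  rw [Finsupp.notMem_support_iff.1 fun h' => hs (hT h'), CharGroup.map_zero]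

lemma zPhase_sub (b : S →₀ CharGroup G) (h c : S →₀ G) :
    zPhase b h * zPhase (-b) (h - c) = zPhase b c := by
  classical
  set T := h.support ∪ c.support ∪ (h - c).support
  rw [zPhase_eq_prod b h T (by grind), zPhase_eq_prod b c T (by grind),
    zPhase_eq_prod (-b) (h - c) T (by grind), ← Finset.prod_mul_distrib]
  refine Finset.prod_congr rfl fun s _ => ?_
  rw [Finsupp.neg_apply, CharGroup.neg_apply, Finsupp.sub_apply, ← CharGroup.map_add]
  congr 1
  abel

lemma zPhase_neg (b : S →₀ CharGroup G) (h : S →₀ G) :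
    zPhase (-b) h = (starRingEnd ℂ) (zPhase b h) := by
  rw [zPhase_eq_prod _ h _ subset_rfl, zPhase_eq_prod _ h _ subset_rfl, map_prod]
  refine Finset.prod_congr rfl fun s _ => ?_
  rw [Finsupp.neg_apply, CharGroup.neg_apply]
  exact AddChar.map_neg_eq_conj (b s : AddChar G ℂ) (h s)

lemma pauliZ_mul_neg (b : S →₀ CharGroup G) : pauliZ b * pauliZ (-b) = 1 := by
  refine Subtype.ext (ContinuousLinearMap.ext fun ψ => lp.ext (funext fun h => ?_))
  change (pauliZ b : SiteHilbert S G →L[ℂ] SiteHilbert S G)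
    ((pauliZ (-b) : SiteHilbert S G →L[ℂ] SiteHilbert S G) ψ) h = ψ h
  have := zPhase_sub b h 0
  rw [sub_zero, zPhase_eq_prod b 0 ∅ (by simp), Finset.prod_empty] at this
  rw [pauliZ_apply, pauliZ_apply, ← mul_assoc, this, one_mul]

lemma pauliX_mul_neg (a : S →₀ G) : pauliX a * pauliX (-a) = 1 := by
  refine Subtype.ext (ContinuousLinearMap.ext fun ψ => lp.ext (funext fun h => ?_))
  change ψ (h - a - -a) = ψ h
  rw [sub_neg_eq_add, sub_add_cancel]

lemma star_pauliZ (b : S →₀ CharGroup G) : star (pauliZ b) = pauliZ (-b) := by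
  refine Subtype.ext ?_
  change ContinuousLinearMap.adjoint _ = _
  refine ((ContinuousLinearMap.eq_adjoint_iff _ _).2 fun ψ φ => ?_).symm
  rw [lp.inner_eq_tsum, lp.inner_eq_tsum]
  refine tsum_congr fun h => ?_
  rw [pauliZ_apply, pauliZ_apply, zPhase_neg]
  simp only [RCLike.inner_apply, map_mul, Complex.conj_conj]
  ring

lemma star_pauliX (a : S →₀ G) : star (pauliX a) = pauliX (-a) := by
  refine Subtype.ext ?_
  change ContinuousLinearMap.adjoint _ = _
  refine ((ContinuousLinearMap.eq_adjoint_iff _ _).2 fun ψ φ => ?_).symm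
  rw [lp.inner_eq_tsum, lp.inner_eq_tsum, ← (Equiv.subRight a).tsum_eq]
  refine tsum_congr fun h => ?_
  rw [pauliX_apply, pauliX_apply, Equiv.subRight_apply, sub_neg_eq_add, sub_add_cancel]

open Filter Topology Classical in
/-- Conjugation by a net of unitaries converges on the quasi-local algebra if it is eventually
constant on every local operator. -/
lemma exists_tendsto_conj (u : Finset S → quasiLocal S G) (hu : ∀ K, u K * star (u K) = 1)
    (hu' : ∀ K, star (u K) * u K = 1)
    (hloc : ∀ (Λ : Finset S) (M : Matrix (Λ → G) (Λ → G) ℂ), ∃ L, ∀ᶠ K in atTop,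
      u K * ⟨localOp Λ M, localOp_mem Λ M⟩ * star (u K) = L) (A : quasiLocal S G) :
    ∃ L, Tendsto (fun K => u K * A * star (u K)) atTop (𝓝 L) := by
  set W := conjConvergent u hu hu' with hW
  have hc : IsClosed (Subtype.val '' (W : Set (quasiLocal S G))) :=
    (isClosed_quasiLocal (S := S) (G := G)).isClosedEmbedding_subtypeVal.isClosedMap _
      (isClosed_conjConvergent u hu hu')
  have hsub : (quasiLocal S G : Set (SiteHilbert S G →L[ℂ] SiteHilbert S G)) ⊆
      Subtype.val '' (W : Set (quasiLocal S G)) := by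
    refine closure_minimal (fun T hT => ?_) hc
    induction hT using StarAlgebra.adjoin_induction with
    | mem x hx =>
      obtain ⟨Λ, M, rfl⟩ := Set.mem_iUnion.1 hx
      obtain ⟨L, hL⟩ := hloc Λ M
      exact ⟨⟨localOp Λ M, localOp_mem Λ M⟩,
        ⟨L, tendsto_const_nhds.congr' (hL.mono fun K h => h.symm)⟩, rfl⟩
    | algebraMap r => exact ⟨_, W.algebraMap_mem r, rfl⟩
    | add x y _ _ hx hy =>
      obtain ⟨x, hx, rfl⟩ := hx
      obtain ⟨y, hy, rfl⟩ := hy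
      exact ⟨_, W.add_mem hx hy, rfl⟩
    | mul x y _ _ hx hy =>
      obtain ⟨x, hx, rfl⟩ := hx
      obtain ⟨y, hy, rfl⟩ := hy
      exact ⟨_, W.mul_mem hx hy, rfl⟩
    | star x _ hx =>
      obtain ⟨x, hx, rfl⟩ := hx
      exact ⟨_, star_mem (S := StarSubalgebra ℂ (quasiLocal S G)) (s := W) hx, rfl⟩
  obtain ⟨B, hB, hBA⟩ := hsub A.2
  rwa [Subtype.ext hBA] at hB

lemma truncate_apply {M : Type*} [AddCommGroup M] {K : Finset S} {c : S → M} {s : S} (hs : s ∈ K) :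
    truncate K c s = c s := by
  simp [truncate, hs]

lemma support_extendConf (Λ : Finset S) (c : Λ → G) : (extendConf Λ c).support ⊆ Λ := by
  unfold extendConf
  exact Finsupp.support_onFinset_subset

open Filter Topology Classical in
/-- The limit which defines `ρ_γ` exists in norm. -/
lemma exists_tendsto_rhoZ (γ : S → CharGroup G) (A : quasiLocal S G) :
    ∃ L, Tendsto (fun K : Finset S => pauliZ (truncate K γ) * A * pauliZ (-truncate K γ))
      atTop (𝓝 L) := by
  simp only [← star_pauliZ]
  refine exists_tendsto_conj _ (fun K => by rw [star_pauliZ, pauliZ_mul_neg])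
    (fun K => by
      have h := pauliZ_mul_neg (-truncate K γ)
      rwa [neg_neg, ← star_pauliZ] at h) (fun Λ M => ?_) A
  refine ⟨pauliZ (truncate Λ γ) * ⟨localOp Λ M, localOp_mem Λ M⟩ *
    star (pauliZ (truncate Λ γ)), (eventually_ge_atTop Λ).mono fun K hK => ?_⟩
  · have key : ∀ (b : S →₀ CharGroup G) (ψ : SiteHilbert S G) (h : S →₀ G),
        ((pauliZ b * ⟨localOp Λ M, localOp_mem Λ M⟩ * star (pauliZ b) : quasiLocal S G) :
          SiteHilbert S G →L[ℂ] SiteHilbert S G) ψ h = ∑ c : Λ → G,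
          M (restrictConf Λ h) (restrictConf Λ h - c) *
            (zPhase b (extendConf Λ c) * ψ (h - extendConf Λ c)) := by
      intro b ψ h
      rw [star_pauliZ]
      change (pauliZ b : SiteHilbert S G →L[ℂ] SiteHilbert S G) (localOp Λ M
        ((pauliZ (-b) : SiteHilbert S G →L[ℂ] SiteHilbert S G) ψ)) h = _
      rw [pauliZ_apply, localOp_apply, Finset.mul_sum]
      refine Finset.sum_congr rfl fun c _ => ?_
      rw [pauliZ_apply, ← zPhase_sub b h (extendConf Λ c)]
      ring
    refine Subtype.ext (ContinuousLinearMap.ext fun ψ => lp.ext (funext fun h => ?_))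
    rw [key, key]
    refine Finset.sum_congr rfl fun c _ => ?_
    congr 2
    rw [zPhase_eq_prod _ _ Λ (support_extendConf Λ c),
      zPhase_eq_prod _ _ Λ (support_extendConf Λ c)]
    exact Finset.prod_congr rfl fun s hs => by rw [truncate_apply (hK hs), truncate_apply hs]

open Filter Topology Classical in
/-- The limit which defines `ρ_δ` exists in norm. -/
lemma exists_tendsto_rhoX (δ : S → G) (A : quasiLocal S G) :
    ∃ L, Tendsto (fun K : Finset S => pauliX (truncate K δ) * A * pauliX (-truncate K δ))
      atTop (𝓝 L) := by
  simp only [← star_pauliX]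
  refine exists_tendsto_conj _ (fun K => by rw [star_pauliX, pauliX_mul_neg])
    (fun K => by
      have h := pauliX_mul_neg (-truncate K δ)
      rwa [neg_neg, ← star_pauliX] at h) (fun Λ M => ?_) A
  refine ⟨pauliX (truncate Λ δ) * ⟨localOp Λ M, localOp_mem Λ M⟩ *
    star (pauliX (truncate Λ δ)), (eventually_ge_atTop Λ).mono fun K hK => ?_⟩
  · have key : ∀ (a : S →₀ G) (ψ : SiteHilbert S G) (h : S →₀ G),
        ((pauliX a * ⟨localOp Λ M, localOp_mem Λ M⟩ * star (pauliX a) : quasiLocal S G) :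
          SiteHilbert S G →L[ℂ] SiteHilbert S G) ψ h = ∑ c : Λ → G,
          M (restrictConf Λ (h - a)) (restrictConf Λ (h - a) - c) * ψ (h - extendConf Λ c) := by
      intro a ψ h
      rw [star_pauliX]
      change localOp Λ M ((pauliX (-a) : SiteHilbert S G →L[ℂ] SiteHilbert S G) ψ) (h - a) = _
      rw [localOp_apply]
      refine Finset.sum_congr rfl fun c _ => ?_
      have e : h - a - extendConf Λ c - -a = h - extendConf Λ c := by abel
      rw [pauliX_apply, e]
    refine Subtype.ext (ContinuousLinearMap.ext fun ψ => lp.ext (funext fun h => ?_))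
    rw [key, key]
    have : restrictConf Λ (h - truncate K δ) = restrictConf Λ (h - truncate Λ δ) := by
      funext s
      simp only [restrictConf, Finsupp.sub_apply]
      rw [truncate_apply (hK s.2), truncate_apply s.2]
    rw [this]

/-- The automorphism `ρ_γ(A) = lim_K Z^{γ_K} A Z^{-γ_K}`. -/
def rhoZ (γ : S → CharGroup G) (A : quasiLocal S G) : quasiLocal S G :=
  Filter.atTop.limUnder fun K : Finset S =>
    pauliZ (truncate K γ) * A * pauliZ (-truncate K γ)

/-- The automorphism `ρ_δ(A) = lim_K X^{δ_K} A X^{-δ_K}`. -/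
def rhoX (δ : S → G) (A : quasiLocal S G) : quasiLocal S G :=
  Filter.atTop.limUnder fun K : Finset S =>
    pauliX (truncate K δ) * A * pauliX (-truncate K δ)

open Filter Topology in
lemma tendsto_rhoZ (γ : S → CharGroup G) (A : quasiLocal S G) :
    Tendsto (fun K : Finset S => pauliZ (truncate K γ) * A * pauliZ (-truncate K γ))
      atTop (𝓝 (rhoZ γ A)) :=
  tendsto_nhds_limUnder (exists_tendsto_rhoZ γ A)

open Filter Topology in
lemma tendsto_rhoX (δ : S → G) (A : quasiLocal S G) :
    Tendsto (fun K : Finset S => pauliX (truncate K δ) * A * pauliX (-truncate K δ))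
      atTop (𝓝 (rhoX δ A)) :=
  tendsto_nhds_limUnder (exists_tendsto_rhoX δ A)

/-- The automorphism `ρ_(γ,δ) = ρ_γ ∘ ρ_δ`. -/
def rho (γ : S → CharGroup G) (δ : S → G) (A : quasiLocal S G) : quasiLocal S G := rhoZ γ (rhoX δ A)

open scoped ComplexOrder in
/-- States on the quasi-local algebra. -/
structure IsState (ω : quasiLocal S G →ₗ[ℂ] ℂ) : Prop where
  nonneg : ∀ A, 0 ≤ ω (star A * A)
  map_one : ω 1 = 1

/-- The frustration free ground states of the system on the `n`-cells `S`: the states with value `1` on all products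
`X^{∂ᵀ c} Z^{∂ d}` of the operators which generate the interaction. Here `c` is a locally
finite `(n - 1)`-cochain and `d` is an `(n + 1)`-chain. -/
structure IsFrustrationFree {A B : Type*} (Dn : Incidence A S) (dn : Incidence S B)
    (ω : quasiLocal S G →ₗ[ℂ] ℂ) : Prop extends IsState ω where
  eq_one : ∀ (c : B →₀ G) (d : A →₀ CharGroup G),
    ω (pauliX (dn.finCoboundary c) * pauliZ (Dn.finBoundary d)) = 1

/-- `π` together with the vector `Ω` is a GNS representation of the state `ω`. -/
structure IsGNS {H : Type*} [NormedAddCommGroup H] [InnerProductSpace ℂ H] [CompleteSpace H]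
    (ω : quasiLocal S G →ₗ[ℂ] ℂ) (π : quasiLocal S G →⋆ₐ[ℂ] (H →L[ℂ] H)) (Ω : H) : Prop where
  cyclic : Dense (Set.range fun A => π A Ω)
  eq_inner : ∀ A, ω A = inner ℂ Ω (π A Ω)

end algebra

end

/-! Two facts carry the proof.

The first is local. The operators `weyl b a` multiply by adding labels, up to a phase, and a phase
disappears under conjugation. Conjugation of a local operator on `Λ` sees only the labels on `Λ`.
Hence, if the labels of a net of Weyl operators are at every site eventually equal to those of `γ`
and `δ`, the conjugations converge to `rho γ δ`: on local operators they eventually agree with the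
truncated conjugations that define `rho γ δ`, and conjugations by unitaries are isometric, so the
agreement passes to the norm closure (`tendsto_weyl_conj`). Truncations of `p` and `q` give such
labels, since each coefficient of `∂p` and `∂ᵀq` involves finitely many cells.

The second is the ground state. A unitary with expectation `1` fixes the cyclic vector, so every `v
= X^{∂ᵀ(q_K)} Z^{∂(p_K)}` satisfies `π(v) π(A) Ω = π(v A v⋆) Ω`. Norm convergence of the
conjugations therefore gives convergence of `π(v)` on the dense set of vectors `π(A) Ω`, and then on
all of `H` because the operators are isometric. The adjoints converge for the same reason, so the
limit `V` is unitary (`IsGNS.exists_unitary_strongLimit`). The transporter is `U = π(Z^{-f} X^{-g})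
V`.

For the intertwining relation, conjugate first by the truncation of `(γ, δ)` to `J` and then by the
unitaries approximating `U`. The labels add up to ones that converge locally to `γ'` and `δ'`, so
the joint limit over `K` and `J` is `rho γ' δ'` (`intertwines_of_strongLimit`). -/

noncomputable section

/-! ### Weyl operators and their conjugation action -/

section weyl

open Filter Topology

variable {S G : Type*} [AddCommGroup G]

lemma CharGroup.add_apply (χ χ' : CharGroup G) (g : G) : (χ + χ') g = χ g * χ' g :=
  AddChar.add_apply (A := G) (M := ℂ) χ χ' g

variable [Fintype G]

lemma zPhase_add_left (b b' : S →₀ CharGroup G) (h : S →₀ G) :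
    zPhase (b + b') h = zPhase b h * zPhase b' h := by
  simp only [zPhase_eq_prod _ h _ subset_rfl, Finsupp.add_apply, CharGroup.add_apply,
    Finset.prod_mul_distrib]

lemma zPhase_add_right (b : S →₀ CharGroup G) (h h' : S →₀ G) :
    zPhase b (h + h') = zPhase b h * zPhase b h' := by
  classical
  set T := h.support ∪ h'.support ∪ (h + h').support
  rw [zPhase_eq_prod b h T (by grind), zPhase_eq_prod b h' T (by grind),
    zPhase_eq_prod b (h + h') T (by grind), ← Finset.prod_mul_distrib]
  simp only [Finsupp.add_apply, CharGroup.map_add]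

lemma zPhase_zero_right (b : S →₀ CharGroup G) : zPhase b (0 : S →₀ G) = 1 := by
  rw [zPhase_eq_prod b 0 ∅ (by simp), Finset.prod_empty]

lemma zPhase_mul_conj (b : S →₀ CharGroup G) (h : S →₀ G) :
    zPhase b h * (starRingEnd ℂ) (zPhase b h) = 1 := by
  rw [← zPhase_neg]
  simpa [zPhase_zero_right] using zPhase_sub b h 0

lemma quasiLocal_ext {A B : quasiLocal S G}
    (h : ∀ (ψ : SiteHilbert S G) (x : S →₀ G),
      (A : SiteHilbert S G →L[ℂ] SiteHilbert S G) ψ x =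
        (B : SiteHilbert S G →L[ℂ] SiteHilbert S G) ψ x) : A = B :=
  Subtype.ext (ContinuousLinearMap.ext fun ψ => lp.ext (funext fun x => h ψ x))

lemma pauliZ_add (b b' : S →₀ CharGroup G) : pauliZ (b + b') = pauliZ b * pauliZ b' := by
  refine quasiLocal_ext fun ψ h => ?_
  change _ = (pauliZ b : SiteHilbert S G →L[ℂ] SiteHilbert S G)
    ((pauliZ b' : SiteHilbert S G →L[ℂ] SiteHilbert S G) ψ) h
  rw [pauliZ_apply, pauliZ_apply, pauliZ_apply, zPhase_add_left, mul_assoc]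

lemma pauliX_add (a a' : S →₀ G) : pauliX (a + a') = pauliX a * pauliX a' := by
  refine quasiLocal_ext fun ψ h => ?_
  change ψ (h - (a + a')) = ψ (h - a - a')
  rw [sub_sub]

/-- The commutation relation behind every phase below: the shift by `a` evaluates the character at
`h - a`, and multiplicativity splits off the factor at `-a`. -/
lemma pauliX_mul_pauliZ (a : S →₀ G) (b : S →₀ CharGroup G) :
    pauliX a * pauliZ b = zPhase b (-a) • (pauliZ b * pauliX a) := by
  refine quasiLocal_ext fun ψ h => ?_
  change (pauliZ b : SiteHilbert S G →L[ℂ] SiteHilbert S G) ψ (h - a) =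
    zPhase b (-a) * (pauliZ b : SiteHilbert S G →L[ℂ] SiteHilbert S G)
      ((pauliX a : SiteHilbert S G →L[ℂ] SiteHilbert S G) ψ) h
  rw [pauliZ_apply, pauliZ_apply, pauliX_apply, sub_eq_add_neg, zPhase_add_right]
  ring

lemma pauliZ_mem_unitary (b : S →₀ CharGroup G) : pauliZ b ∈ unitary (quasiLocal S G) := by
  refine ⟨?_, ?_⟩
  · rw [star_pauliZ]
    simpa using pauliZ_mul_neg (-b)
  · rw [star_pauliZ, pauliZ_mul_neg]

lemma pauliX_mem_unitary (a : S →₀ G) : pauliX a ∈ unitary (quasiLocal S G) := by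
  refine ⟨?_, ?_⟩
  · rw [star_pauliX]
    simpa using pauliX_mul_neg (-a)
  · rw [star_pauliX, pauliX_mul_neg]

/-- The Weyl operator `Z^b X^a`. -/
def weyl (b : S →₀ CharGroup G) (a : S →₀ G) : quasiLocal S G := pauliZ b * pauliX a

lemma weyl_mem_unitary (b : S →₀ CharGroup G) (a : S →₀ G) :
    weyl b a ∈ unitary (quasiLocal S G) :=
  mul_mem (pauliZ_mem_unitary b) (pauliX_mem_unitary a)

/-- Two elements which differ by a phase. -/
def PhaseEq (u v : quasiLocal S G) : Prop :=
  ∃ c : ℂ, c * (starRingEnd ℂ) c = 1 ∧ u = c • v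

/-- The phase meets its complex conjugate. Hence the order of the `X` and `Z` factors is irrelevant
for conjugation. -/
lemma PhaseEq.conj_eq {u v : quasiLocal S G} (h : PhaseEq u v) (A : quasiLocal S G) :
    u * A * star u = v * A * star v := by
  obtain ⟨c, hc, rfl⟩ := h
  rw [star_smul, smul_mul_assoc, smul_mul_assoc, mul_smul_comm, smul_smul]
  change (c * (starRingEnd ℂ) c) • _ = _
  rw [hc, one_smul]

/-- Weyl operators form a projective representation of the group of labels: moving `X^a` past
`Z^{b'}` costs only a phase. Compositions of conjugations thus reduce to sums of labels. -/
lemma phaseEq_weyl_mul (b b' : S →₀ CharGroup G) (a a' : S →₀ G) :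
    PhaseEq (weyl b a * weyl b' a') (weyl (b + b') (a + a')) := by
  refine ⟨zPhase b' (-a), zPhase_mul_conj _ _, ?_⟩
  have h : weyl b a * weyl b' a' = pauliZ b * (pauliX a * pauliZ b') * pauliX a' := by
    simp only [weyl, mul_assoc]
  rw [h, pauliX_mul_pauliZ, weyl, pauliZ_add, pauliX_add]
  simp only [mul_smul_comm, smul_mul_assoc, mul_assoc]

lemma phaseEq_pauliX_mul_pauliZ (a : S →₀ G) (b : S →₀ CharGroup G) :
    PhaseEq (pauliX a * pauliZ b) (weyl b a) :=
  ⟨zPhase b (-a), zPhase_mul_conj _ _, pauliX_mul_pauliZ a b⟩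

/-- Conjugation by a Weyl operator acts on the local operators on `Λ` through the restriction
to `Λ`. -/
lemma weyl_conj_localOp_congr {Λ : Finset S} {b b' : S →₀ CharGroup G} {a a' : S →₀ G}
    (hb : ∀ s ∈ Λ, b s = b' s) (ha : ∀ s ∈ Λ, a s = a' s) (M : Matrix (Λ → G) (Λ → G) ℂ) :
    weyl b a * ⟨localOp Λ M, localOp_mem Λ M⟩ * star (weyl b a) =
      weyl b' a' * ⟨localOp Λ M, localOp_mem Λ M⟩ * star (weyl b' a') := by
  classical
  -- The phases of `Z^b` at `h` and of `Z^{-b}` at `h - c` combine to the phase at `c`, which lives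
  -- on `Λ`; the shift by `a` enters only through the restriction of `h - a` to `Λ`.
  have key : ∀ (b : S →₀ CharGroup G) (a : S →₀ G) (ψ : SiteHilbert S G) (h : S →₀ G),
      ((weyl b a * ⟨localOp Λ M, localOp_mem Λ M⟩ * star (weyl b a) : quasiLocal S G) :
        SiteHilbert S G →L[ℂ] SiteHilbert S G) ψ h = ∑ c : Λ → G,
        M (restrictConf Λ (h - a)) (restrictConf Λ (h - a) - c) *
          (zPhase b (extendConf Λ c) * ψ (h - extendConf Λ c)) := by
    intro b a ψ h
    rw [weyl, star_mul, star_pauliZ, star_pauliX]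
    change (pauliZ b : SiteHilbert S G →L[ℂ] SiteHilbert S G)
      ((pauliX a : SiteHilbert S G →L[ℂ] SiteHilbert S G) (localOp Λ M
      ((pauliX (-a) : SiteHilbert S G →L[ℂ] SiteHilbert S G)
        ((pauliZ (-b) : SiteHilbert S G →L[ℂ] SiteHilbert S G) ψ)))) h = _
    rw [pauliZ_apply, pauliX_apply, localOp_apply, Finset.mul_sum]
    refine Finset.sum_congr rfl fun c _ => ?_
    have e : h - a - extendConf Λ c - -a = h - extendConf Λ c := by abel
    rw [pauliX_apply, pauliZ_apply, e, ← zPhase_sub b h (extendConf Λ c)]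
    ring
  refine quasiLocal_ext fun ψ h => ?_
  rw [key, key]
  have hr : restrictConf Λ (h - a) = restrictConf Λ (h - a') := by
    funext s
    simp only [restrictConf, Finsupp.sub_apply, ha s s.2]
  rw [hr]
  refine Finset.sum_congr rfl fun c _ => ?_
  congr 2
  rw [zPhase_eq_prod _ _ Λ (support_extendConf Λ c),
    zPhase_eq_prod _ _ Λ (support_extendConf Λ c)]
  exact Finset.prod_congr rfl fun s hs => by rw [hb s hs]

end weyl

/-! ### Asymptotic agreement of conjugations by unitaries -/

section conjDifference

open Filter Topology

lemma norm_unitary_conj {R : Type*} [CStarAlgebra R] {u : R} (hu : u ∈ unitary R) (A : R) :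
    ‖u * A * star u‖ = ‖A‖ := by
  rw [CStarRing.norm_mul_mem_unitary _ (Unitary.star_mem hu), CStarRing.norm_mem_unitary_mul _ hu]

variable {R ι : Type*} [CStarAlgebra R] {l : Filter ι} {u v : ι → R}

/-- The elements on which conjugations by two nets of unitaries agree asymptotically. -/
def conjAgree (l : Filter ι) (hu : ∀ i, u i ∈ unitary R) (hv : ∀ i, v i ∈ unitary R) :
    StarSubalgebra ℂ R where
  carrier := {A | Tendsto (fun i => u i * A * star (u i) - v i * A * star (v i)) l (𝓝 0)}
  mul_mem' := by
    intro A B hA hB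
    -- Telescoping: with `α`, `β` the two conjugations, `α(AB) - β(AB) = (α(A) - β(A)) α(B) + β(A)
    -- (α(B) - β(B))`, where the factors `α(B)` and `β(A)` have constant norm.
    have h1 : Tendsto (fun i => (u i * A * star (u i) - v i * A * star (v i)) *
        (u i * B * star (u i))) l (𝓝 0) := by
      refine squeeze_zero_norm (fun i => norm_mul_le _ _) ?_
      simp only [norm_unitary_conj (hu _)]
      simpa using hA.norm.mul_const ‖B‖
    have h2 : Tendsto (fun i => v i * A * star (v i) *
        (u i * B * star (u i) - v i * B * star (v i))) l (𝓝 0) := by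
      refine squeeze_zero_norm (fun i => norm_mul_le _ _) ?_
      simp only [norm_unitary_conj (hv _)]
      simpa using hB.norm.const_mul ‖A‖
    have h3 := h1.add h2
    rw [add_zero] at h3
    refine h3.congr fun i => ?_
    have e : ∀ w ∈ unitary R, w * (A * B) * star w = w * A * star w * (w * B * star w) := by
      intro w hw
      calc w * (A * B) * star w = w * A * 1 * B * star w := by simp only [mul_one, mul_assoc]
        _ = w * A * (star w * w) * B * star w := by rw [Unitary.star_mul_self_of_mem hw]
        _ = _ := by simp only [mul_assoc]
    rw [e _ (hu i), e _ (hv i), sub_mul, mul_sub]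
    abel
  add_mem' := by
    intro A B hA hB
    have h := hA.add hB
    rw [add_zero] at h
    refine h.congr fun i => ?_
    simp only [mul_add, add_mul]
    abel
  algebraMap_mem' c := by
    refine tendsto_const_nhds.congr fun i => ?_
    rw [← Algebra.commutes, mul_assoc, Unitary.mul_star_self_of_mem (hu i),
      ← Algebra.commutes, mul_assoc, Unitary.mul_star_self_of_mem (hv i), sub_self]
  star_mem' := by
    intro A hA
    have h := hA.star
    rw [star_zero] at h
    refine h.congr fun i => ?_
    simp only [star_sub, star_mul, star_star, mul_assoc]

/-- Replacing `A` by a nearby `B` changes each conjugate by at most `‖A - B‖`, uniformly in the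
index, so an `ε / 3` argument applies. -/
lemma isClosed_conjAgree (hu : ∀ i, u i ∈ unitary R) (hv : ∀ i, v i ∈ unitary R) :
    IsClosed (conjAgree l hu hv : Set R) := by
  refine isClosed_of_closure_subset fun A hA => ?_
  change Tendsto _ _ _
  refine Metric.tendsto_nhds.2 fun ε hε => ?_
  obtain ⟨B, hB, hAB⟩ := Metric.mem_closure_iff.1 hA (ε / 3) (by positivity)
  refine (Metric.tendsto_nhds.1 hB (ε / 3) (by positivity)).mono fun i hi => ?_
  rw [dist_zero_right] at hi ⊢
  rw [dist_eq_norm] at hAB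
  have e : u i * A * star (u i) - v i * A * star (v i) =
      u i * (A - B) * star (u i) + (u i * B * star (u i) - v i * B * star (v i)) -
        v i * (A - B) * star (v i) := by
    simp only [mul_sub, sub_mul]
    abel
  rw [e]
  refine (norm_sub_le _ _).trans_lt ?_
  have h1 := norm_add_le (u i * (A - B) * star (u i))
    (u i * B * star (u i) - v i * B * star (v i))
  rw [norm_unitary_conj (hu i)] at h1
  rw [norm_unitary_conj (hv i)]
  linarith

end conjDifference

/-! ### Convergence of Weyl conjugations to `rho` -/

section weylLimit

open Filter Topology

variable {S G ι : Type*} [AddCommGroup G] [Fintype G] {l : Filter ι}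

/-- The elements with asymptotic agreement form a closed star subalgebra; once it contains the local
operators it is everything. Comparing two nets avoids having to identify a limit. -/
lemma tendsto_conj_sub_conj {u v : ι → quasiLocal S G} (hu : ∀ i, u i ∈ unitary (quasiLocal S G))
    (hv : ∀ i, v i ∈ unitary (quasiLocal S G))
    (hloc : ∀ (Λ : Finset S) (M : Matrix (Λ → G) (Λ → G) ℂ), ∀ᶠ i in l,
      u i * ⟨localOp Λ M, localOp_mem Λ M⟩ * star (u i) =
        v i * ⟨localOp Λ M, localOp_mem Λ M⟩ * star (v i)) (A : quasiLocal S G) :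
    Tendsto (fun i => u i * A * star (u i) - v i * A * star (v i)) l (𝓝 0) := by
  set W := conjAgree l hu hv with hW
  have hc : IsClosed (Subtype.val '' (W : Set (quasiLocal S G))) :=
    (isClosed_quasiLocal (S := S) (G := G)).isClosedEmbedding_subtypeVal.isClosedMap _
      (isClosed_conjAgree hu hv)
  have hsub : (quasiLocal S G : Set (SiteHilbert S G →L[ℂ] SiteHilbert S G)) ⊆
      Subtype.val '' (W : Set (quasiLocal S G)) := by
    refine closure_minimal (fun T hT => ?_) hc
    induction hT using StarAlgebra.adjoin_induction with
    | mem x hx =>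
      obtain ⟨Λ, M, rfl⟩ := Set.mem_iUnion.1 hx
      exact ⟨⟨localOp Λ M, localOp_mem Λ M⟩,
        tendsto_const_nhds.congr' ((hloc Λ M).mono fun i h => (sub_eq_zero.2 h).symm), rfl⟩
    | algebraMap r => exact ⟨_, W.algebraMap_mem r, rfl⟩
    | add x y _ _ hx hy =>
      obtain ⟨x, hx, rfl⟩ := hx
      obtain ⟨y, hy, rfl⟩ := hy
      exact ⟨_, W.add_mem hx hy, rfl⟩
    | mul x y _ _ hx hy =>
      obtain ⟨x, hx, rfl⟩ := hx
      obtain ⟨y, hy, rfl⟩ := hy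
      exact ⟨_, W.mul_mem hx hy, rfl⟩
    | star x _ hx =>
      obtain ⟨x, hx, rfl⟩ := hx
      exact ⟨_, star_mem (S := StarSubalgebra ℂ (quasiLocal S G)) (s := W) hx, rfl⟩
  obtain ⟨B, hB, hBA⟩ := hsub A.2
  rwa [Subtype.ext hBA] at hB

/-- `rho` is an iterated limit, first over the `X` truncations and then over the `Z` truncations.
Because conjugation by `Z` is isometric, the error of the inner limit is not amplified, and a single
limit along the diagonal suffices. -/
lemma tendsto_weyl_truncate_conj (γ : S → CharGroup G) (δ : S → G) (A : quasiLocal S G) :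
    Tendsto (fun K : Finset S => weyl (truncate K γ) (truncate K δ) * A *
      star (weyl (truncate K γ) (truncate K δ))) atTop (𝓝 (rho γ δ A)) := by
  have h1 : Tendsto (fun K : Finset S => pauliZ (truncate K γ) *
      (pauliX (truncate K δ) * A * pauliX (-truncate K δ) - rhoX δ A) *
        star (pauliZ (truncate K γ))) atTop (𝓝 0) := by
    refine tendsto_zero_iff_norm_tendsto_zero.2 ?_
    simp only [norm_unitary_conj (pauliZ_mem_unitary _)]
    simpa using ((tendsto_rhoX δ A).sub_const (rhoX δ A)).norm
  have h2 := h1.add (tendsto_rhoZ γ (rhoX δ A))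
  rw [zero_add] at h2
  refine h2.congr fun K => ?_
  simp only [weyl, star_mul, star_pauliZ, star_pauliX, mul_sub, sub_mul, mul_assoc]
  abel

/-- Conjugations by Weyl operators converge to `ρ_(γ,δ)` if their labels converge locally to `γ`
and `δ`. -/
lemma tendsto_weyl_conj {b : ι → S →₀ CharGroup G} {a : ι → S →₀ G} {γ : S → CharGroup G}
    {δ : S → G} (hb : ∀ s, ∀ᶠ i in l, b i s = γ s) (ha : ∀ s, ∀ᶠ i in l, a i s = δ s)
    (A : quasiLocal S G) :
    Tendsto (fun i => weyl (b i) (a i) * A * star (weyl (b i) (a i))) l (𝓝 (rho γ δ A)) := by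
  -- The given net and the truncations have different index sets, so they are compared on the
  -- product filter.
  have hd : Tendsto (fun x : ι × Finset S => weyl (b x.1) (a x.1) * A *
      star (weyl (b x.1) (a x.1)) - weyl (truncate x.2 γ) (truncate x.2 δ) * A *
        star (weyl (truncate x.2 γ) (truncate x.2 δ))) (l ×ˢ atTop) (𝓝 0) := by
    refine tendsto_conj_sub_conj (fun _ => weyl_mem_unitary _ _) (fun _ => weyl_mem_unitary _ _)
      (fun Λ M => ?_) A
    have h1 : ∀ᶠ i in l, ∀ s ∈ Λ, b i s = γ s ∧ a i s = δ s :=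
      (Finset.eventually_all Λ).2 fun s _ => (hb s).and (ha s)
    refine (h1.prod_mk (eventually_ge_atTop Λ)).mono fun x hx => ?_
    refine weyl_conj_localOp_congr (fun s hs => ?_) (fun s hs => ?_) M
    · rw [(hx.1 s hs).1, truncate_apply (hx.2 hs)]
    · rw [(hx.1 s hs).2, truncate_apply (hx.2 hs)]
  have h := hd.add ((tendsto_weyl_truncate_conj γ δ A).comp tendsto_snd)
  simp only [Function.comp_def, sub_add_cancel, zero_add] at h
  have h' : Tendsto ((fun i => weyl (b i) (a i) * A * star (weyl (b i) (a i))) ∘ Prod.fst)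
    (l ×ˢ (atTop : Filter (Finset S))) (𝓝 (rho γ δ A)) := h
  -- The function depends on the first coordinate only, and `atTop` is nontrivial, so the product
  -- filter projects onto `l`.
  rwa [← tendsto_map'_iff, map_fst_prod] at h'

end weylLimit

/-! ### Strong limits of isometries and unitaries -/

section strongLimit

open Filter Topology

variable {H ι : Type*} [NormedAddCommGroup H] [InnerProductSpace ℂ H] {l : Filter ι}

/-- If isometries converge strongly, their values on convergent nets converge. -/
lemma tendsto_apply_of_strongLimit {T : ι → H →L[ℂ] H} (hT : ∀ i x, ‖T i x‖ = ‖x‖)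
    {V : H →L[ℂ] H} (hV : ∀ x, Tendsto (fun i => T i x) l (𝓝 (V x))) {y : ι → H} {z : H}
    (hy : Tendsto y l (𝓝 z)) : Tendsto (fun i => T i (y i)) l (𝓝 (V z)) := by
  have h1 : Tendsto (fun i => T i (y i - z)) l (𝓝 0) := by
    refine tendsto_zero_iff_norm_tendsto_zero.2 ?_
    simp only [hT]
    simpa using (hy.sub_const z).norm
  have h := h1.add (hV z)
  rw [zero_add] at h
  exact h.congr fun i => by rw [map_sub, sub_add_cancel]

variable [CompleteSpace H]

lemma unitary_apply_norm {W : H →L[ℂ] H} (hW : W ∈ unitary (H →L[ℂ] H)) (x : H) :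
    ‖W x‖ = ‖x‖ :=
  ContinuousLinearMap.norm_map_of_mem_unitary hW x

variable [NeBot l]

/-- A net of isometries which converges pointwise on a dense set converges strongly. -/
lemma exists_strongLimit_of_dense {T : ι → H →L[ℂ] H} (hT : ∀ i x, ‖T i x‖ = ‖x‖) {D : Set H}
    (hD : Dense D) (hconv : ∀ x ∈ D, ∃ y, Tendsto (fun i => T i x) l (𝓝 y)) :
    ∃ V : H →L[ℂ] H, ∀ x, Tendsto (fun i => T i x) l (𝓝 (V x)) := by
  have hall : ∀ x, ∃ y, Tendsto (fun i => T i x) l (𝓝 y) := by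
    intro x
    -- For `z` in the dense set within `ε / 4` of `x`, the values at `x` eventually lie within `ε /
    -- 2` of the limit `y` at `z`.
    refine cauchy_map_iff_exists_tendsto.1 (Metric.cauchy_iff.2 ⟨inferInstance, fun ε hε => ?_⟩)
    obtain ⟨z, hzD, hz⟩ := Metric.mem_closure_iff.1 (hD x) (ε / 4) (by positivity)
    obtain ⟨y, hy⟩ := hconv z hzD
    refine ⟨Metric.ball y (ε / 2), ?_, fun a ha b hb => ?_⟩
    · refine mem_map.2 ((Metric.tendsto_nhds.1 hy (ε / 4) (by positivity)).mono fun i hi => ?_)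
      have h1 : dist (T i x) (T i z) < ε / 4 := by
        rwa [dist_eq_norm, ← map_sub, hT, ← dist_eq_norm]
      have h2 := dist_triangle (T i x) (T i z) y
      change dist (T i x) y < ε / 2
      linarith
    · have h := dist_triangle_right a b y
      rw [Metric.mem_ball] at ha hb
      linarith
  choose V hV using hall
  let L : H →ₗ[ℂ] H :=
    linearMapOfTendsto V (fun i => (T i : H →ₗ[ℂ] H)) (tendsto_pi_nhds.2 hV)
  refine ⟨L.mkContinuous 1 fun x => ?_, hV⟩
  have h : Tendsto (fun i => ‖T i x‖) l (𝓝 ‖V x‖) := (hV x).norm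
  simp only [hT] at h
  rw [one_mul]
  exact (tendsto_nhds_unique h tendsto_const_nhds).le

/-- A strong limit of unitaries is unitary if the adjoints converge strongly as well. -/
lemma mem_unitary_of_strongLimit {T : ι → H →L[ℂ] H} (hT : ∀ i, T i ∈ unitary (H →L[ℂ] H))
    {V W : H →L[ℂ] H} (hV : ∀ x, Tendsto (fun i => T i x) l (𝓝 (V x)))
    (hW : ∀ x, Tendsto (fun i => star (T i) x) l (𝓝 (W x))) : V ∈ unitary (H →L[ℂ] H) := by
  have hVW : star V = W := by
    -- The adjoint relation of `T i` and `star (T i)` survives weak limits. The two products below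
    -- need more: strong convergence of both nets, together with isometry.
    refine ((ContinuousLinearMap.eq_adjoint_iff W V).2 fun x y => ?_).symm
    have h1 : Tendsto (fun i => inner ℂ (star (T i) x) y) l (𝓝 (inner ℂ (W x) y)) :=
      (hW x).inner tendsto_const_nhds
    have h2 : Tendsto (fun i => inner ℂ x (T i y)) l (𝓝 (inner ℂ x (V y))) :=
      tendsto_const_nhds.inner (hV y)
    refine tendsto_nhds_unique h1 (h2.congr fun i => ?_)
    exact (ContinuousLinearMap.adjoint_inner_left (T i) y x).symm
  rw [Unitary.mem_iff, hVW]
  constructor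
  · ext x
    have h := tendsto_apply_of_strongLimit
      (fun i x => unitary_apply_norm (Unitary.star_mem (hT i)) x) hW (hV x)
    refine tendsto_nhds_unique h (tendsto_const_nhds.congr fun i => ?_)
    change _ = (star (T i) * T i) x
    rw [Unitary.star_mul_self_of_mem (hT i)]
  · ext x
    have h := tendsto_apply_of_strongLimit (fun i x => unitary_apply_norm (hT i) x) hV (hW x)
    refine tendsto_nhds_unique h (tendsto_const_nhds.congr fun i => ?_)
    change _ = (T i * star (T i)) x
    rw [Unitary.mul_star_self_of_mem (hT i)]

end strongLimit

/-! ### Unitaries fixing the cyclic vector -/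

section gns

open Filter Topology

variable {S G ι : Type*} [AddCommGroup G] [Fintype G]
  {H : Type*} [NormedAddCommGroup H] [InnerProductSpace ℂ H] [CompleteSpace H]
  {ω : quasiLocal S G →ₗ[ℂ] ℂ} {π : quasiLocal S G →⋆ₐ[ℂ] (H →L[ℂ] H)} {Ω : H}

lemma map_mem_unitary (π : quasiLocal S G →⋆ₐ[ℂ] (H →L[ℂ] H)) {u : quasiLocal S G}
    (hu : u ∈ unitary (quasiLocal S G)) : π u ∈ unitary (H →L[ℂ] H) := by
  rw [Unitary.mem_iff] at hu ⊢
  rw [← map_star, ← map_mul, ← map_mul, hu.1, hu.2, map_one]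
  exact ⟨rfl, rfl⟩

/-- The cyclic vector is fixed by the unitaries on which the state has the value `1`. -/
lemma IsGNS.fixed_of_eq_one (hω : IsState ω) (h : IsGNS ω π Ω) {u : quasiLocal S G}
    (hu : u ∈ unitary (quasiLocal S G)) (h1 : ω u = 1) : π u Ω = Ω := by
  have hΩ : inner ℂ Ω Ω = (1 : ℂ) := by
    have h2 := h.eq_inner 1
    rw [hω.map_one, map_one] at h2
    exact h2.symm
  have hu1 : inner ℂ Ω (π u Ω) = (1 : ℂ) := by rw [← h.eq_inner, h1]
  have hn : ‖Ω‖ ^ 2 = 1 := by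
    rw [← inner_self_eq_norm_sq (𝕜 := ℂ), hΩ, RCLike.one_re]
  -- Equality case of Cauchy–Schwarz: both vectors have norm one and inner product one, so the
  -- square expands to `1 - 2 + 1`.
  have hd : ‖π u Ω - Ω‖ ^ 2 = 0 := by
    rw [@norm_sub_sq ℂ, ← inner_re_symm, hu1, unitary_apply_norm (map_mem_unitary π hu), hn]
    norm_num
  exact sub_eq_zero.1 (norm_eq_zero.1 (pow_eq_zero_iff two_ne_zero |>.1 hd))

-- Star homomorphisms between C*-algebras are automatically continuous, which carries norm limits
-- over to the representation.
open scoped CStarAlgebra in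
lemma continuous_representation (π : quasiLocal S G →⋆ₐ[ℂ] (H →L[ℂ] H)) : Continuous π :=
  map_continuous π

lemma tendsto_representation_apply {l : Filter ι} (π : quasiLocal S G →⋆ₐ[ℂ] (H →L[ℂ] H))
    {A : ι → quasiLocal S G} {L : quasiLocal S G} (hA : Tendsto A l (𝓝 L)) (x : H) :
    Tendsto (fun i => π (A i) x) l (𝓝 (π L x)) :=
  ((ContinuousLinearMap.apply ℂ H x).continuous.tendsto _).comp
    (((continuous_representation π).tendsto L).comp hA)

/-- Unitaries which fix the cyclic vector converge strongly in the GNS representation if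
conjugation by them converges in norm. -/
lemma IsGNS.exists_strongLimit {l : Filter ι} [NeBot l] (h : IsGNS ω π Ω) {v : ι → quasiLocal S G}
    (hv : ∀ i, v i ∈ unitary (quasiLocal S G)) (hfix : ∀ i, π (v i) Ω = Ω)
    (hconv : ∀ A, ∃ L, Tendsto (fun i => v i * A * star (v i)) l (𝓝 L)) :
    ∃ V : H →L[ℂ] H, ∀ x, Tendsto (fun i => π (v i) x) l (𝓝 (V x)) := by
  refine exists_strongLimit_of_dense
    (fun i x => unitary_apply_norm (map_mem_unitary π (hv i)) x) h.cyclic ?_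
  rintro _ ⟨A, rfl⟩
  obtain ⟨L, hL⟩ := hconv A
  refine ⟨π L Ω, (tendsto_representation_apply π hL Ω).congr fun i => ?_⟩
  -- Inserting `π (v i) Ω = Ω` on the right turns conjugation of `A` into left multiplication by `v
  -- i`.
  have e : π (v i * A * star (v i)) (π (v i) Ω) = π (v i * A * star (v i) * v i) Ω := by
    rw [map_mul π _ (v i)]
    rfl
  rw [hfix] at e
  rw [e, mul_assoc, Unitary.star_mul_self_of_mem (hv i), mul_one, map_mul]
  rfl

end gns

/-! ### Truncated chains and the charge transporter -/

section transport

open Filter Topology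

variable {A S B G M : Type*} [AddCommGroup G] [AddCommGroup M]

lemma eventually_truncate_apply (c : S → M) (s : S) :
    ∀ᶠ K : Finset S in atTop, truncate K c s = c s :=
  (eventually_ge_atTop {s}).mono fun _ hK => truncate_apply (hK (Finset.mem_singleton_self s))

/-- The coefficient at `s` involves only the finitely many cofaces of `s`; it is exact once `K`
contains them. The coboundary below uses faces in the same way. -/
lemma Incidence.eventually_finBoundary_truncate (D : Incidence A S) (p : A → M) (s : S) :
    ∀ᶠ K : Finset A in atTop, D.finBoundary (truncate K p) s = D.boundary p s := by
  refine (eventually_ge_atTop (D.finite_cofaces s).toFinset).mono fun K hK => ?_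
  refine finsum_congr fun α => ?_
  by_cases h : D.coeff α s = 0
  · rw [h, zero_smul, zero_smul]
  · rw [truncate_apply (hK ((Set.Finite.mem_toFinset _).2 h))]

lemma Incidence.eventually_finCoboundary_truncate (d : Incidence S B) (q : B → M) (s : S) :
    ∀ᶠ K : Finset B in atTop, d.finCoboundary (truncate K q) s = d.coboundary q s := by
  refine (eventually_ge_atTop (d.finite_faces s).toFinset).mono fun K hK => ?_
  refine finsum_congr fun β => ?_
  by_cases h : d.coeff s β = 0
  · rw [h, zero_smul, zero_smul]
  · rw [truncate_apply (hK ((Set.Finite.mem_toFinset _).2 h))]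

/-- Serves for both boundary and coboundary: equality in the quotient at infinity supplies the
membership of `-c + c'`, and the finite part changes sign to become `f`. -/
lemma exists_eq_sub_add_of_sub_mem {N : Type*} [AddCommGroup N] (φ : N →+ (S → M)) {c c' : S → M}
    (h : -c + c' ∈ finiteChains S M ⊔ φ.range) :
    ∃ (f : S →₀ M) (p : N), c' = c - ⇑f + φ p := by
  obtain ⟨x, hx, _, ⟨p, rfl⟩, hxy⟩ := AddSubgroup.mem_sup.1 h
  have hx' : (Function.support x).Finite := hx
  refine ⟨-Finsupp.ofSupportFinite x hx', p, ?_⟩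
  rw [Finsupp.coe_neg, Finsupp.ofSupportFinite_coe, sub_neg_eq_add, add_assoc, hxy]
  abel

lemma eventually_finBoundary_fst (D : Incidence A S) (p : A → CharGroup G) (s : S) :
    ∀ᶠ K : Finset A × Finset B in atTop,
      D.finBoundary (truncate K.1 p) s = D.boundary p s := by
  rw [← prod_atTop_atTop_eq]
  exact tendsto_fst.eventually (D.eventually_finBoundary_truncate p s)

lemma eventually_finCoboundary_snd (d : Incidence S B) (q : B → G) (s : S) :
    ∀ᶠ K : Finset A × Finset B in atTop,
      d.finCoboundary (truncate K.2 q) s = d.coboundary q s := by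
  rw [← prod_atTop_atTop_eq]
  exact tendsto_snd.eventually (d.eventually_finCoboundary_truncate q s)

variable [Fintype G]
  {H : Type*} [NormedAddCommGroup H] [InnerProductSpace ℂ H] [CompleteSpace H]
  {ω : quasiLocal S G →ₗ[ℂ] ℂ} {π : quasiLocal S G →⋆ₐ[ℂ] (H →L[ℂ] H)} {Ω : H}
  {D : Incidence A S} {d : Incidence S B}

/-- The operators `X^{∂ᵀ(q_K)} Z^{∂(p_K)}`. -/
def stabilizerNet (D : Incidence A S) (d : Incidence S B) (p : A → CharGroup G) (q : B → G)
    (K : Finset A × Finset B) : quasiLocal S G :=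
  pauliX (d.finCoboundary (truncate K.2 q)) * pauliZ (D.finBoundary (truncate K.1 p))

lemma stabilizerNet_mem_unitary (p : A → CharGroup G) (q : B → G) (K : Finset A × Finset B) :
    stabilizerNet D d p q K ∈ unitary (quasiLocal S G) :=
  mul_mem (pauliX_mem_unitary _) (pauliZ_mem_unitary _)

/-- In the GNS representation of a frustration free state, the operators `X^{∂ᵀ(q_K)} Z^{∂(p_K)}`
converge strongly to a unitary. -/
lemma IsGNS.exists_unitary_strongLimit (hω : IsFrustrationFree D d ω) (h : IsGNS ω π Ω)
    (p : A → CharGroup G) (q : B → G) :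
    ∃ V : H →L[ℂ] H, V ∈ unitary (H →L[ℂ] H) ∧
      ∀ x, Tendsto (fun K => π (stabilizerNet D d p q K) x) atTop (𝓝 (V x)) := by
  classical
  have hu := stabilizerNet_mem_unitary (D := D) (d := d) p q
  have hfix : ∀ K, π (stabilizerNet D d p q K) Ω = Ω := fun K =>
    h.fixed_of_eq_one hω.toIsState (hu K) (hω.eq_one _ _)
  -- The phases relating these products to Weyl operators may vary with `K`; only the conjugations
  -- have to converge, and `hfix` pins down the phase of the operators themselves.
  obtain ⟨V, hV⟩ := h.exists_strongLimit (l := atTop) hu hfix fun T =>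
    ⟨_, (tendsto_weyl_conj (eventually_finBoundary_fst D p)
      (eventually_finCoboundary_snd d q) T).congr fun K =>
        ((phaseEq_pauliX_mul_pauliZ _ _).conj_eq T).symm⟩
  have hstar : ∀ K, star (stabilizerNet D d p q K) =
      weyl (-D.finBoundary (truncate K.1 p)) (-d.finCoboundary (truncate K.2 q)) := fun K => by
    rw [stabilizerNet, star_mul, star_pauliX, star_pauliZ, weyl]
  have hfix' : ∀ K, π (star (stabilizerNet D d p q K)) Ω = Ω := fun K => by
    have e : π (star (stabilizerNet D d p q K)) (π (stabilizerNet D d p q K) Ω) =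
        π (star (stabilizerNet D d p q K) * stabilizerNet D d p q K) Ω := by
      rw [map_mul]
      rfl
    rw [hfix, Unitary.star_mul_self_of_mem (hu K), map_one] at e
    exact e
  -- A strong limit of unitaries may fail to be surjective, so the adjoints need a limit of their
  -- own. They are Weyl operators with negated labels.
  obtain ⟨W, hW⟩ := h.exists_strongLimit (l := atTop) (fun K => Unitary.star_mem (hu K)) hfix'
    fun T => by
      simp only [hstar]
      refine ⟨_, tendsto_weyl_conj (γ := -D.boundary p) (δ := -d.coboundary q)
        (fun s => (eventually_finBoundary_fst D p s).mono fun K hK => ?_)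
        (fun s => (eventually_finCoboundary_snd d q s).mono fun K hK => ?_) T⟩
      · rw [Finsupp.neg_apply, hK, Pi.neg_apply]
      · rw [Finsupp.neg_apply, hK, Pi.neg_apply]
  refine ⟨V, mem_unitary_of_strongLimit (W := W) (fun K => map_mem_unitary π (hu K)) hV fun x => ?_, hV⟩
  simpa only [map_star] using hW x

/-- The strong limit of `Z^{-f} X^{-g} X^{∂ᵀ(q_K)} Z^{∂(p_K)}` intertwines the two automorphisms. -/
lemma intertwines_of_strongLimit (π : quasiLocal S G →⋆ₐ[ℂ] (H →L[ℂ] H))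
    {γ γ' : S → CharGroup G} {δ δ' : S → G} {f : S →₀ CharGroup G} {g : S →₀ G}
    {p : A → CharGroup G} {q : B → G} (hγ : γ' = γ - ⇑f + D.boundary p)
    (hδ : δ' = δ - ⇑g + d.coboundary q) {U : H →L[ℂ] H}
    (hU : ∀ x, Tendsto (fun K => π (weyl (-f) (-g) * stabilizerNet D d p q K) x) atTop (𝓝 (U x)))
    (T : quasiLocal S G) : U * π (rho γ δ T) = π (rho γ' δ' T) * U := by
  classical
  set u : Finset A × Finset B → quasiLocal S G :=
    fun K => weyl (-f) (-g) * stabilizerNet D d p q K with hu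
  have hmem : ∀ K, u K ∈ unitary (quasiLocal S G) := fun K =>
    mul_mem (weyl_mem_unitary _ _) (stabilizerNet_mem_unitary p q K)
  have hT : ∀ K x, ‖π (u K) x‖ = ‖x‖ := fun K => unitary_apply_norm (map_mem_unitary π (hmem K))
  set w : Finset S → quasiLocal S G := fun J => weyl (truncate J γ) (truncate J δ) with hw
  -- Up to phase, `u K * w J` has labels `-f + ∂(p_K) + γ_J` and `-g + ∂ᵀ(q_K) + δ_J`, which at each
  -- site are eventually those of `γ'` and `δ'`.
  have hconj : Tendsto (fun x : (Finset A × Finset B) × Finset S =>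
      u x.1 * (w x.2 * T * star (w x.2)) * star (u x.1)) (atTop ×ˢ atTop)
      (𝓝 (rho γ' δ' T)) := by
    refine (tendsto_weyl_conj
      (b := fun x : (Finset A × Finset B) × Finset S =>
        -f + (D.finBoundary (truncate x.1.1 p) + truncate x.2 γ))
      (a := fun x => -g + (d.finCoboundary (truncate x.1.2 q) + truncate x.2 δ))
      (fun s => ?_) (fun s => ?_) T).congr fun x => ?_
    · refine ((eventually_finBoundary_fst D p s).prod_mk (eventually_truncate_apply γ s)).mono
        fun x hx => ?_
      simp only [Finsupp.add_apply, Finsupp.neg_apply, hx.1, hx.2, hγ, Pi.add_apply, Pi.sub_apply]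
      abel
    · refine ((eventually_finCoboundary_snd d q s).prod_mk (eventually_truncate_apply δ s)).mono
        fun x hx => ?_
      simp only [Finsupp.add_apply, Finsupp.neg_apply, hx.1, hx.2, hδ, Pi.add_apply, Pi.sub_apply]
      abel
    · rw [← (phaseEq_weyl_mul _ _ _ _).conj_eq]
      have e : ∀ a b : quasiLocal S G, a * b * T * star (a * b) = a * (b * T * star b) * star a :=
        fun a b => by simp only [star_mul, mul_assoc]
      rw [e, ← (phaseEq_weyl_mul _ _ _ _).conj_eq, e,
        ← (phaseEq_pauliX_mul_pauliZ _ _).conj_eq (weyl _ _ * T * star (weyl _ _))]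
      simp only [hu, hw, stabilizerNet, star_mul, mul_assoc]
  ext x
  -- Both sides of the intertwining relation are limits of the same net: `u (w T w⋆) = (u w T w⋆ u⋆)
  -- u`. Here a strong limit is applied to a convergent vector; in `hR` a norm limit of operators
  -- is.
  have hL : Tendsto (fun y : (Finset A × Finset B) × Finset S =>
      π (u y.1) (π (w y.2 * T * star (w y.2)) x)) (atTop ×ˢ atTop) (𝓝 (U (π (rho γ δ T) x))) :=
    tendsto_apply_of_strongLimit (T := fun y : (Finset A × Finset B) × Finset S => π (u y.1))
      (fun y => hT y.1) (fun z => (hU z).comp tendsto_fst)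
      ((tendsto_representation_apply π (tendsto_weyl_truncate_conj γ δ T) x).comp tendsto_snd)
  have hR : Tendsto (fun y : (Finset A × Finset B) × Finset S =>
      π (u y.1 * (w y.2 * T * star (w y.2)) * star (u y.1)) (π (u y.1) x)) (atTop ×ˢ atTop)
      (𝓝 (π (rho γ' δ' T) (U x))) := by
    have h1 := ((continuous_representation π).tendsto _).comp hconj
    exact (isBoundedBilinearMap_apply.continuous.tendsto (π (rho γ' δ' T), U x)).comp
      (h1.prodMk_nhds ((hU x).comp tendsto_fst))
  refine tendsto_nhds_unique hL (hR.congr fun y => ?_)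
  have e : ∀ a b : quasiLocal S G, π a (π b x) = π (a * b) x := fun a b => by
    rw [map_mul]
    rfl
  rw [e, e, mul_assoc _ (star _), Unitary.star_mul_self_of_mem (hmem _), mul_one]

/-- The strong limit of `Z^{-f} X^{-g} X^{∂ᵀ(q_K)} Z^{∂(p_K)}` in the GNS representation of a
frustration free state exists and is a unitary charge transporter. -/
lemma IsGNS.exists_transporter (hω : IsFrustrationFree D d ω) (h : IsGNS ω π Ω)
    {γ γ' : S → CharGroup G} {δ δ' : S → G} {f : S →₀ CharGroup G} {g : S →₀ G}
    {p : A → CharGroup G} {q : B → G} (hγ : γ' = γ - ⇑f + D.boundary p)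
    (hδ : δ' = δ - ⇑g + d.coboundary q) :
    ∃ U : H →L[ℂ] H,
      (∀ x : H, Tendsto (fun K : Finset A × Finset B =>
        π (pauliZ (-f) * pauliX (-g) * pauliX (d.finCoboundary (truncate K.2 q)) *
          pauliZ (D.finBoundary (truncate K.1 p))) x) atTop (𝓝 (U x))) ∧
      U ∈ unitary (H →L[ℂ] H) ∧
      (∀ T : quasiLocal S G, U * π (rho γ δ T) = π (rho γ' δ' T) * U) ∧
      π (pauliX g * pauliZ f) (U Ω) = Ω := by
  classical
  obtain ⟨V, hVu, hV⟩ := h.exists_unitary_strongLimit hω p q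
  have hU : ∀ x, Tendsto (fun K => π (weyl (-f) (-g) * stabilizerNet D d p q K) x) atTop
      (𝓝 ((π (weyl (-f) (-g)) * V) x)) := fun x => by
    simp only [map_mul π (weyl (-f) (-g))]
    exact ((π (weyl (-f) (-g))).continuous.tendsto _).comp (hV x)
  refine ⟨π (weyl (-f) (-g)) * V, fun x => ?_,
    mul_mem (map_mem_unitary π (weyl_mem_unitary _ _)) hVu,
    intertwines_of_strongLimit π hγ hδ hU, ?_⟩
  · simpa only [weyl, stabilizerNet, mul_assoc] using hU x
  · have hVΩ : V Ω = Ω := by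
      refine tendsto_nhds_unique (hV Ω) (tendsto_const_nhds.congr fun K => ?_)
      exact (h.fixed_of_eq_one hω.toIsState (stabilizerNet_mem_unitary p q K)
        (hω.eq_one _ _)).symm
    have e : π (pauliX g * pauliZ f) ((π (weyl (-f) (-g)) * V) Ω) =
        π (pauliX g * pauliZ f * weyl (-f) (-g)) (V Ω) := by
      rw [map_mul π _ (weyl (-f) (-g))]
      rfl
    -- The factors stand in reverse order, so they cancel exactly, without a phase.
    have e1 : pauliX g * pauliZ f * weyl (-f) (-g) = 1 := by
      rw [weyl, mul_assoc, ← mul_assoc (pauliZ f), pauliZ_mul_neg, one_mul, pauliX_mul_neg]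
    rw [e, e1, map_one, hVΩ]
    rfl

end transport

end

/-! ### The proposition for the cells of a CW complex -/

open Filter Topology in
theorem proposition8p1
    -- a cell complex `E` with oriented cells
    {X : Type*} [TopologicalSpace X] [T2Space X] (E : Set X) [CWComplex E]
    (o : CellOrientation E) (hE : HasFiniteCofaces E o)
    -- a finite abelian group `G` and the dimension `n` of the cells which carry the qudits
    {G : Type*} [AddCommGroup G] [Fintype G] (n : ℕ)
    -- a frustration free ground state `ω₀` and its GNS representation
    (ω₀ : quasiLocal (Cells E (n + 1)) G →ₗ[ℂ] ℂ)
    (hω₀ : IsFrustrationFree (cellIncidence o hE (n + 1)) (cellIncidence o hE n) ω₀)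
    {H : Type*} [NormedAddCommGroup H] [InnerProductSpace ℂ H] [CompleteSpace H]
    (π₀ : quasiLocal (Cells E (n + 1)) G →⋆ₐ[ℂ] (H →L[ℂ] H)) (Ω₀ : H)
    (hπ₀ : IsGNS ω₀ π₀ Ω₀)
    -- locally finite `n`-chains and `n`-cochains with the same classes at infinity
    (γ γ' : cyclesAtInfinity (cellIncidence o hE n) (CharGroup G))
    (hγ : (γ : HomologyAtInfinity (cellIncidence o hE (n + 1)) (cellIncidence o hE n)
      (CharGroup G)) = γ')
    (δ δ' : cocyclesAtInfinity (cellIncidence o hE (n + 1)) G)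
    (hδ : (δ : CohomologyAtInfinity (cellIncidence o hE (n + 1)) (cellIncidence o hE n) G) = δ') :
    (∃ (γh : Cells E (n + 1) →₀ CharGroup G) (p : Cells E (n + 1 + 1) → CharGroup G),
      (γ' : Cells E (n + 1) → CharGroup G) =
        (γ : Cells E (n + 1) → CharGroup G) - ⇑γh + (cellIncidence o hE (n + 1)).boundary p) ∧
    (∃ (δh : Cells E (n + 1) →₀ G) (q : Cells E n → G),
      (δ' : Cells E (n + 1) → G) =
        (δ : Cells E (n + 1) → G) - ⇑δh + (cellIncidence o hE n).coboundary q) ∧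
    ∀ (γh : Cells E (n + 1) →₀ CharGroup G) (δh : Cells E (n + 1) →₀ G)
      (p : Cells E (n + 1 + 1) → CharGroup G) (q : Cells E n → G),
      (γ' : Cells E (n + 1) → CharGroup G) =
        (γ : Cells E (n + 1) → CharGroup G) - ⇑γh + (cellIncidence o hE (n + 1)).boundary p →
      (δ' : Cells E (n + 1) → G) =
        (δ : Cells E (n + 1) → G) - ⇑δh + (cellIncidence o hE n).coboundary q →
      ∃ U : H →L[ℂ] H,
        (∀ x : H, Tendsto
          (fun K : Finset (Cells E (n + 1 + 1)) × Finset (Cells E n) =>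
            π₀ (pauliZ (-γh) * pauliX (-δh) *
              pauliX ((cellIncidence o hE n).finCoboundary (truncate K.2 q)) *
              pauliZ ((cellIncidence o hE (n + 1)).finBoundary (truncate K.1 p))) x)
          atTop (𝓝 (U x))) ∧
        U ∈ unitary (H →L[ℂ] H) ∧
        (∀ A : quasiLocal (Cells E (n + 1)) G,
          U * π₀ (rho (γ : Cells E (n + 1) → CharGroup G) (δ : Cells E (n + 1) → G) A) =
            π₀ (rho (γ' : Cells E (n + 1) → CharGroup G) (δ' : Cells E (n + 1) → G) A) * U) ∧
        π₀ (pauliX δh * pauliZ γh) (U Ω₀) = Ω₀ := by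
  refine ⟨?_, ?_, fun γh δh p q hγh hδh => hπ₀.exists_transporter hω₀ hγh hδh⟩
  · exact exists_eq_sub_add_of_sub_mem _
      (AddSubgroup.mem_addSubgroupOf.1 (QuotientAddGroup.eq.1 hγ))
  · exact exists_eq_sub_add_of_sub_mem _
      (AddSubgroup.mem_addSubgroupOf.1 (QuotientAddGroup.eq.1 hδ))
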